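/- Let $\rho\ge 1$ and let $\mu$ be a probability measure on $\mathbb R$ with cumulative distribution function $F(x)=\mu((-\infty,x])$ and quantile function $F^{-1}(u)=\inf\{x\in\mathbb R: F(x)\ge u\}$, $u\in(0,1)$. Let $\mathcal W_\rho(\nu,\eta)=\inf_\pi\left(\int_{\mathbb R^2}|x-y|^\rho\,\pi(dx,dy)\right)^{1/\rho}\in[0,+\infty]$, the infimum being over all couplings $\pi$ of $\nu$ and $\eta$, denote the Wasserstein distance with index $\rho$ and, for $N\ge 1$, let $$e_N(\mu,\rho)=\inf\left\{\mathcal W_\rho\left(\frac1N\sum_{i=1}^N\delta_{x_i},\mu\right):-\infty<x_1\le\cdots\le x_N<+\infty\right\}.$$ Write $\mu(dx)=f(x)\,dx+\mu_{\rm sing}(dx)$ with $f:\mathbb R\to[0,+\infty)$ Borel and $\mu_{\rm sing}$ singular with respect to the Lebesgue measure, and let $A\subset\mathbb R$ be a Borel set such that $\mu_{\rm sing}(A)=0$ and $\mathbb R\setminus A$ has Lebesgue measure $0$. Set $$I=\int_0^1\frac{\mathbf 1_A(F^{-1}(u))}{f^\rho(F^{-1}(u))}\,du\in[0,+\infty],$$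 where the integrand is understood as $0$ when $F^{-1}(u)\notin A$. Then $$\liminf_{N\to+\infty}N e_N(\mu,\rho)\ge\frac{1}{2(\rho+1)^{1/\rho}}\,I^{1/\rho}.$$ If moreover $f(x)>0$ for Lebesgue-almost every $x$ in $\{x\in\mathbb R:0<F(x)<1\}$, then $$\sup_{N\ge1}N e_N(\mu,\rho)\le\sup_{N\ge 1}N\,\mathcal W_\rho\left(\frac1N\sum_{i=1}^N\delta_{F^{-1}\left(\frac{2i-1}{2N}\right)},\mu\right)\le\frac{1}{2\rho^{1/\rho}}\,I^{1/\rho}$$ and $$\lim_{N\to+\infty}N e_N(\mu,\rho)=\lim_{N\to+\infty}N\,\mathcal W_\rho\left(\frac1N\sum_{i=1}^N\delta_{F^{-1}\left(\frac{2i-1}{2N}\right)},\mu\right)=\frac{1}{2(\rho+1)^{1/\rho}}\,I^{1/\rho}.$$ All quantities take values in $[0,+\infty]$, and the right-hand sides may be infinite. -/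

import Mathlib

open MeasureTheory Filter Topology
open scoped ENNReal

namespace EmpiricalApprox

/-- Wasserstein distance of index `ρ` between two measures on the real line: the infimum of
`(∫ |x - y| ^ ρ π(dx, dy)) ^ (1 / ρ)` over all couplings `π`, with values in `[0, ∞]`. -/
noncomputable def wasserstein (ρ : ℝ) (ν η : Measure ℝ) : ℝ≥0∞ :=
  (⨅ (π : Measure (ℝ × ℝ)) (_ : π.map Prod.fst = ν) (_ : π.map Prod.snd = η),
    ∫⁻ p, ENNReal.ofReal (|p.1 - p.2| ^ ρ) ∂π) ^ (1 / ρ)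

/-- The measure giving weight `1 / N` to each of the points `x₁, …, x_N`
(with multiplicity). -/
noncomputable def empirical {N : ℕ} (x : Fin N → ℝ) : Measure ℝ :=
  (N : ℝ≥0∞)⁻¹ • ∑ i, Measure.dirac (x i)

/-- `e_N(μ, ρ)`, the minimal Wasserstein error of `N` ordered points with equal weights. -/
noncomputable def minError (N : ℕ) (μ : Measure ℝ) (ρ : ℝ) : ℝ≥0∞ :=
  ⨅ (x : Fin N → ℝ) (_ : Monotone x), wasserstein ρ (empirical x) μ

/-- The quantile function `u ↦ inf {x | u ≤ F x}`, to be used for `0 < u < 1`. -/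
noncomputable def quantile (μ : Measure ℝ) (u : ℝ) : ℝ :=
  sInf {x : ℝ | u ≤ ProbabilityTheory.cdf μ x}

/-- The points `F⁻¹((2 i - 1) / (2 N))` for `i = 1, …, N`; the index of the code starts at `0`. -/
noncomputable def midQuantiles (N : ℕ) (μ : Measure ℝ) (i : Fin N) : ℝ :=
  quantile μ ((2 * ((i : ℕ) + 1 : ℝ) - 1) / (2 * (N : ℝ)))

/-- The integral over `(0, 1)` of `1_A(F⁻¹(u)) / f(F⁻¹(u)) ^ ρ`, with values in `[0, ∞]`. -/
noncomputable def densityIntegral (μ : Measure ℝ) (A : Set ℝ) (f : ℝ → ℝ) (ρ : ℝ) : ℝ≥0∞ :=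
  ∫⁻ u in Set.Ioo (0 : ℝ) 1,
    A.indicator (fun _ => (1 : ℝ≥0∞)) (quantile μ u) / ENNReal.ofReal (f (quantile μ u) ^ ρ)

end EmpiricalApprox

open EmpiricalApprox

/-! Write `q` for the quantile function. Since |x - y|^ρ is convex, the monotone coupling is
optimal, so W_ρ^ρ between N ordered points and `μ` is ∫ |x_{⌊Nu⌋} - q(u)|^ρ du
(`wasserstein_empirical`, through explicit Kantorovich potentials). Everything then happens inside
the cells [i/N, (i+1)/N], described by an index i and a phase w in (0,1).

Lower bound: pair the phases w and 1 - w. By convexity the mean cost of sending two values of `q` to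
one point is at least (half their distance)^ρ, wherever the point is. As `q` is monotone, it is
differentiable a.e., and N times the half-distance tends to |w - 1/2| q'(u). Fatou and ∫ |w - 1/2|^ρ
dw = 1 / (2^ρ (ρ+1)) conclude, because q' = 1 / f(q) wherever q(u) ∈ A.

Upper bounds: positivity of `f` makes `q` absolutely continuous with q' = 1_A(q) / f(q)
(`ofReal_quantile_sub_le`). Hölder between the midpoint of a cell and the phase w bounds the
rescaled cost of the midpoint quantiles by |w - 1/2|^(ρ-1) times N times the integral of q'^ρ
between them. Pairing w with 1 - w again gives the constant with ρ, uniformly in N. For the limit,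
the costs are dominated by the cell averages of q'^ρ, which converge a.e. without changing their
integral; a generalised dominated convergence theorem gives the constant with ρ + 1, matching the
lower bound. -/

namespace EmpiricalApprox

/-! ### The quantile function and its pushforward of the uniform law. -/

section Quantile

variable {μ : Measure ℝ}

lemma setOf_le_cdf_nonempty (μ : Measure ℝ) {u : ℝ} (hu : u < 1) :
    {x : ℝ | u ≤ ProbabilityTheory.cdf μ x}.Nonempty :=
  ((ProbabilityTheory.tendsto_cdf_atTop μ).eventually_const_le hu).exists

lemma setOf_le_cdf_bddBelow (μ : Measure ℝ) {u : ℝ} (hu : 0 < u) :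
    BddBelow {x : ℝ | u ≤ ProbabilityTheory.cdf μ x} := by
  obtain ⟨y, hy⟩ := ((ProbabilityTheory.tendsto_cdf_atBot μ).eventually_lt_const hu).exists
  refine ⟨y, fun x hx => ?_⟩
  by_contra! h
  exact absurd (ProbabilityTheory.monotone_cdf μ h.le) (not_le.2 (hy.trans_le hx))

/-- The infimum defining the quantile is attained, by right continuity of the cdf. -/
lemma le_cdf_quantile (μ : Measure ℝ) {u : ℝ} (hu : u ∈ Set.Ioo (0 : ℝ) 1) :
    u ≤ ProbabilityTheory.cdf μ (quantile μ u) := by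
  have hc := (ProbabilityTheory.cdf μ).right_continuous (quantile μ u)
  refine le_of_tendsto_of_tendsto tendsto_const_nhds
    (hc.mono_left (nhdsWithin_mono _ Set.Ioi_subset_Ici_self)) ?_
  filter_upwards [self_mem_nhdsWithin] with x hx
  obtain ⟨y, hy, hyx⟩ := exists_lt_of_csInf_lt (setOf_le_cdf_nonempty μ hu.2) hx
  exact le_trans hy (ProbabilityTheory.monotone_cdf μ hyx.le)

lemma quantile_le_iff (μ : Measure ℝ) {u : ℝ} (hu : u ∈ Set.Ioo (0 : ℝ) 1) {x : ℝ} :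
    quantile μ u ≤ x ↔ u ≤ ProbabilityTheory.cdf μ x :=
  ⟨fun h => (le_cdf_quantile μ hu).trans (ProbabilityTheory.monotone_cdf μ h),
    fun h => csInf_le (setOf_le_cdf_bddBelow μ hu.1) h⟩

lemma monotoneOn_quantile (μ : Measure ℝ) : MonotoneOn (quantile μ) (Set.Ioo 0 1) :=
  fun _ hu _ hv huv => (quantile_le_iff μ hu).2 (huv.trans (le_cdf_quantile μ hv))

/-- Outside (0, 1] the quantile takes the default value 0, as `sInf` of the whole line or of the
empty set. This is needed only for measurability on all of ℝ. -/
lemma quantile_of_nonpos (μ : Measure ℝ) {u : ℝ} (hu : u ≤ 0) : quantile μ u = 0 := by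
  have : {x : ℝ | u ≤ ProbabilityTheory.cdf μ x} = Set.univ :=
    Set.eq_univ_of_forall fun x => hu.trans (ProbabilityTheory.cdf_nonneg μ x)
  simp [quantile, this]

lemma quantile_of_one_lt (μ : Measure ℝ) {u : ℝ} (hu : 1 < u) : quantile μ u = 0 := by
  have : {x : ℝ | u ≤ ProbabilityTheory.cdf μ x} = ∅ :=
    Set.eq_empty_of_forall_notMem fun x hx =>
      absurd (ProbabilityTheory.cdf_le_one μ x) (not_le.2 (hu.trans_le hx))
  simp [quantile, this]

lemma measurable_quantile (μ : Measure ℝ) : Measurable (quantile μ) := by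
  refine measurable_of_Iic fun x => ?_
  have : quantile μ ⁻¹' Set.Iic x =
      (Set.Ioo 0 1 ∩ Set.Iic (ProbabilityTheory.cdf μ x)) ∪
      ((Set.Iic 0 ∪ Set.Ioi 1) ∩ {_u | (0 : ℝ) ≤ x}) ∪
      -- At u = 1 the defining set may or may not be empty, so this single point is kept apart.
      ({1} ∩ {_u | quantile μ 1 ≤ x}) := by
    ext u
    simp only [Set.mem_preimage, Set.mem_Iic, Set.mem_union, Set.mem_inter_iff, Set.mem_Ioi,
      Set.mem_ofPred_eq, Set.mem_singleton_iff]
    rcases le_or_gt u 0 with h0 | h0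
    · have : u ≠ 1 := by linarith
      simp [quantile_of_nonpos μ h0, h0, this, not_lt.2 h0]
    rcases lt_trichotomy u 1 with h1 | h1 | h1
    · simp [quantile_le_iff μ ⟨h0, h1⟩, h0, h1, h1.ne, not_lt.2 h1.le]
    · subst h1; simp
    · simp [quantile_of_one_lt μ h1, h1, h1.ne', not_lt.2 h1.le]
  rw [this]
  refine ((measurableSet_Ioo.inter measurableSet_Iic).union
    ((measurableSet_Iic.union measurableSet_Ioi).inter (MeasurableSet.const _))).union
    ((measurableSet_singleton _).inter (MeasurableSet.const _))

lemma map_quantile (μ : Measure ℝ) [IsProbabilityMeasure μ] :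
    (volume.restrict (Set.Ioo (0 : ℝ) 1)).map (quantile μ) = μ := by
  have hp : IsProbabilityMeasure (volume.restrict (Set.Ioo (0 : ℝ) 1)) := ⟨by simp⟩
  have hp' : IsProbabilityMeasure ((volume.restrict (Set.Ioo (0 : ℝ) 1)).map (quantile μ)) :=
    Measure.isProbabilityMeasure_map (measurable_quantile μ).aemeasurable
  refine Measure.ext_of_Iic _ _ fun x => ?_
  rw [Measure.map_apply (measurable_quantile μ) measurableSet_Iic,
    Measure.restrict_apply (measurable_quantile μ measurableSet_Iic),
    ← ProbabilityTheory.ofReal_cdf μ x]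
  have h1 := ProbabilityTheory.cdf_le_one μ x
  apply le_antisymm
  · calc _ ≤ volume (Set.Ioc 0 (ProbabilityTheory.cdf μ x)) := by
          refine measure_mono fun u hu => ⟨hu.2.1, (quantile_le_iff μ hu.2).1 hu.1⟩
      _ = _ := by simp
  · calc _ = volume (Set.Ioo 0 (ProbabilityTheory.cdf μ x)) := by simp
      _ ≤ _ := by
          refine measure_mono fun u hu => ?_
          have hu' : u ∈ Set.Ioo (0 : ℝ) 1 := ⟨hu.1, hu.2.trans_le h1⟩
          exact ⟨(quantile_le_iff μ hu').2 hu.2.le, hu'⟩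

lemma ae_quantile_of_ae (μ : Measure ℝ) [IsProbabilityMeasure μ] {p : ℝ → Prop}
    (h : ∀ᵐ x ∂μ, p x) : ∀ᵐ u ∂(volume.restrict (Set.Ioo (0 : ℝ) 1)), p (quantile μ u) := by
  rw [← map_quantile μ] at h
  exact ae_of_ae_map (measurable_quantile μ).aemeasurable h

end Quantile

/-! ### Differentiation of the cdf and of the quantile function. -/

section Density

variable {μ μsing : Measure ℝ} {f : ℝ → ℝ} {A : Set ℝ}

lemma measure_restrict_of_sing_eq_zero
    (hμ : μ = volume.withDensity (fun x => ENNReal.ofReal (f x)) + μsing)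
    (hA : MeasurableSet A) (hAsing : μsing A = 0) :
    μ.restrict A = (volume.restrict A).withDensity (fun x => ENNReal.ofReal (f x)) := by
  rw [hμ, Measure.restrict_add, restrict_withDensity hA, Measure.restrict_eq_zero.2 hAsing,
    add_zero]

/-- On `A` the measure `μ` has a density, so Lebesgue-null exceptional sets are also `μ`-null there.
-/
lemma ae_mem_imp_of_ae_volume
    (hμ : μ = volume.withDensity (fun x => ENNReal.ofReal (f x)) + μsing)
    (hA : MeasurableSet A) (hAsing : μsing A = 0) {p : ℝ → Prop} (h : ∀ᵐ x, p x) :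
    ∀ᵐ x ∂μ, x ∈ A → p x := by
  rw [← ae_restrict_iff' hA, measure_restrict_of_sing_eq_zero hμ hA hAsing]
  exact (withDensity_absolutelyContinuous _ _).ae_le (ae_restrict_of_ae h)

/-- `A` witnesses the singularity of `μsing`, so `f` is a version of the Radon–Nikodym derivative,
and Lebesgue differentiation applies. -/
lemma ae_hasDerivAt_cdf [IsProbabilityMeasure μ] (hf : Measurable f) (hf0 : ∀ x, 0 ≤ f x)
    (hμ : μ = volume.withDensity (fun x => ENNReal.ofReal (f x)) + μsing)
    (hA : MeasurableSet A) (hAsing : μsing A = 0) (hAvol : volume Aᶜ = 0) :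
    ∀ᵐ x, HasDerivAt (ProbabilityTheory.cdf μ) (f x) x := by
  have hs : μsing ⟂ₘ volume := ⟨A, hA, hAsing, hAvol⟩
  have hr := Measure.eq_rnDeriv (μ := μ) (ν := volume) hf.ennreal_ofReal hs (by rw [hμ, add_comm])
  filter_upwards [(ProbabilityTheory.cdf μ).ae_hasDerivAt, hr] with x hx hrx
  rw [ProbabilityTheory.measure_cdf, ← hrx, ENNReal.toReal_ofReal (hf0 x)] at hx
  exact hx

lemma cdf_quantile_of_continuousAt {u : ℝ} (hu : u ∈ Set.Ioo (0 : ℝ) 1)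
    (hc : ContinuousAt (ProbabilityTheory.cdf μ) (quantile μ u)) :
    ProbabilityTheory.cdf μ (quantile μ u) = u := by
  refine le_antisymm ?_ (le_cdf_quantile μ hu)
  refine le_of_tendsto (hc.tendsto.mono_left (nhdsWithin_le_nhds (s := Set.Iio (quantile μ u)))) ?_
  filter_upwards [self_mem_nhdsWithin] with x hx
  by_contra! h
  exact absurd ((quantile_le_iff μ hu).2 h.le) (not_le.2 hx)

/-- At a point where the quantile function and the cdf are both differentiable, `F ∘ F⁻¹ - id`
has a local minimum, so the derivatives are inverse to each other. -/
lemma hasDerivAt_quantile_mul_eq_one {u g d : ℝ} (hu : u ∈ Set.Ioo (0 : ℝ) 1)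
    (hg : HasDerivAt (quantile μ) g u)
    (hd : HasDerivAt (ProbabilityTheory.cdf μ) d (quantile μ u)) : g * d = 1 := by
  have h := (hd.comp u hg).sub (hasDerivAt_id u)
  have hmin : IsLocalMin (ProbabilityTheory.cdf μ ∘ quantile μ - id) u := by
    filter_upwards [isOpen_Ioo.mem_nhds hu] with v hv
    simp only [Pi.sub_apply, Function.comp, id, cdf_quantile_of_continuousAt hu hd.continuousAt,
      sub_self]
    linarith [le_cdf_quantile μ hv]
  linarith [hmin.hasDerivAt_eq_zero h]

lemma ae_hasDerivAt_quantile [IsProbabilityMeasure μ] (hf : Measurable f) (hf0 : ∀ x, 0 ≤ f x)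
    (hμ : μ = volume.withDensity (fun x => ENNReal.ofReal (f x)) + μsing)
    (hA : MeasurableSet A) (hAsing : μsing A = 0) (hAvol : volume Aᶜ = 0) :
    ∀ᵐ u ∂(volume.restrict (Set.Ioo (0 : ℝ) 1)), u ∈ Set.Ioo (0 : ℝ) 1 ∧
      ∃ g, HasDerivAt (quantile μ) g u ∧ (quantile μ u ∈ A → g * f (quantile μ u) = 1) := by
  have h1 := ae_quantile_of_ae μ (ae_mem_imp_of_ae_volume hμ hA hAsing
    (ae_hasDerivAt_cdf hf hf0 hμ hA hAsing hAvol))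
  have h2 := (monotoneOn_quantile μ).ae_differentiableWithinAt measurableSet_Ioo
  filter_upwards [h1, h2, ae_restrict_mem measurableSet_Ioo] with u hu1 hu2 hu
  have hd := (hu2.differentiableAt (isOpen_Ioo.mem_nhds hu)).hasDerivAt
  exact ⟨hu, _, hd, fun hq => hasDerivAt_quantile_mul_eq_one hu hd (hu1 hq)⟩

end Density

/-- The uniform distribution on the unit interval. -/
noncomputable abbrev unif : Measure ℝ := volume.restrict (Set.Ioo (0 : ℝ) 1)

/-! ### Splitting the unit interval into N cells. -/

section Partition

lemma lintegral_Ioc_partition {N : ℕ} (hN : 0 < N) (F : ℝ → ℝ≥0∞) (k : ℕ) :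
    ∫⁻ u in Set.Ioc (0 : ℝ) (k / N), F u =
      ∑ i ∈ Finset.range k, ∫⁻ u in Set.Ioc ((i : ℝ) / N) ((i + 1) / N), F u := by
  have hN' : (0 : ℝ) < N := by exact_mod_cast hN
  induction k with
  | zero => simp
  | succ k ih =>
    rw [Finset.sum_range_succ, ← ih, ← lintegral_union measurableSet_Ioc]
    · rw [Set.Ioc_union_Ioc_eq_Ioc (by positivity) (by gcongr; linarith)]
      push_cast; rfl
    · exact Set.Ioc_disjoint_Ioc_of_le le_rfl

lemma lintegral_Ioc_div (N : ℕ) (hN : 0 < N) (F : ℝ → ℝ≥0∞) (i : ℕ) :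
    ∫⁻ u in Set.Ioc ((i : ℝ) / N) ((i + 1) / N), F u =
      (N : ℝ≥0∞)⁻¹ * ∫⁻ w, F ((i + w) / N) ∂unif := by
  have hN' : (0 : ℝ) < N := by exact_mod_cast hN
  have himg : (fun w : ℝ => (i + w) / N) '' Set.Ioo 0 1 = Set.Ioo ((i : ℝ) / N) ((i + 1) / N) := by
    ext u
    simp only [Set.mem_image, Set.mem_Ioo]
    constructor
    · rintro ⟨w, ⟨h0, h1⟩, rfl⟩
      exact ⟨by gcongr; linarith, by gcongr⟩
    · rintro ⟨h0, h1⟩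
      rw [div_lt_iff₀ hN'] at h0
      rw [lt_div_iff₀ hN'] at h1
      exact ⟨u * N - i, ⟨by linarith, by linarith⟩, by field_simp; ring⟩
  have hd : ∀ w ∈ Set.Ioo (0 : ℝ) 1,
      HasDerivWithinAt (fun w : ℝ => (i + w) / N) (1 / N) (Set.Ioo 0 1) w := fun w _ =>
    (((hasDerivAt_id w).const_add (i : ℝ)).div_const (N : ℝ)).hasDerivWithinAt
  have hinj : Set.InjOn (fun w : ℝ => (i + w) / N) (Set.Ioo 0 1) := fun a _ b _ h => by
    have := (div_left_inj' hN'.ne').1 h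
    linarith
  rw [← restrict_Ioo_eq_restrict_Ioc, ← himg,
    lintegral_image_eq_lintegral_abs_deriv_mul measurableSet_Ioo hd hinj, lintegral_const_mul']
  · congr 1
    rw [abs_of_pos (by positivity), one_div, ENNReal.ofReal_inv_of_pos hN', ENNReal.ofReal_natCast]
  · simp

lemma lintegral_unif_partition {N : ℕ} (hN : 0 < N) (F : ℝ → ℝ≥0∞) :
    ∫⁻ u, F u ∂unif =
      (N : ℝ≥0∞)⁻¹ * ∑ i ∈ Finset.range N, ∫⁻ w, F ((i + w) / N) ∂unif := by
  have hN' : (N : ℝ) ≠ 0 := by exact_mod_cast hN.ne'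
  have h := lintegral_Ioc_partition hN F N
  rw [div_self hN', ← restrict_Ioo_eq_restrict_Ioc] at h
  rw [h, Finset.mul_sum]
  exact Finset.sum_congr rfl fun i _ => lintegral_Ioc_div N hN F i

lemma floor_mul_div {N : ℕ} (hN : 0 < N) (i : ℕ) {w : ℝ} (hw : w ∈ Set.Ioo (0 : ℝ) 1) :
    ⌊(N : ℝ) * ((i + w) / N)⌋₊ = i := by
  have hN' : (N : ℝ) ≠ 0 := by exact_mod_cast hN.ne'
  rw [mul_div_cancel₀ _ hN', Nat.floor_eq_iff (by have := hw.1; positivity)]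
  exact ⟨by linarith [hw.1], by linarith [hw.2]⟩

lemma lintegral_unif_floor {N : ℕ} (hN : 0 < N) (F : ℕ → ℝ≥0∞) :
    ∫⁻ u, F ⌊(N : ℝ) * u⌋₊ ∂unif = (N : ℝ≥0∞)⁻¹ * ∑ i ∈ Finset.range N, F i := by
  rw [lintegral_unif_partition hN]
  congr 1
  refine Finset.sum_congr rfl fun i _ => ?_
  rw [setLIntegral_congr_fun (g := fun _ => F i) measurableSet_Ioo
    fun w hw => by simp only [floor_mul_div hN i hw]]
  simp

/-- Keeping the cell of u but redrawing its phase w uniformly leaves the uniform law unchanged. All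
costs are put in this form, with u fixed and w averaged. -/
lemma lintegral_unif_phase {N : ℕ} (hN : 0 < N) (F : ℝ → ℝ≥0∞) :
    ∫⁻ u, F u ∂unif = ∫⁻ u, ∫⁻ w, F ((⌊(N : ℝ) * u⌋₊ + w) / N) ∂unif ∂unif := by
  rw [lintegral_unif_floor hN fun i => ∫⁻ w, F ((i + w) / N) ∂unif, lintegral_unif_partition hN]

lemma measurable_comp_floor_mul {β : Type*} [MeasurableSpace β] (N : ℕ) (x : ℕ → β) :
    Measurable fun u : ℝ => x ⌊(N : ℝ) * u⌋₊ :=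
  (measurable_from_nat (f := x)).comp (Nat.measurable_floor.comp (measurable_const_mul _))

lemma map_unif_floor {N : ℕ} (hN : 0 < N) (x : ℕ → ℝ) :
    unif.map (fun u => x ⌊(N : ℝ) * u⌋₊) = empirical fun i : Fin N => x i := by
  ext s hs
  rw [← lintegral_indicator_one hs,
    lintegral_map (measurable_one.indicator hs) (measurable_comp_floor_mul N x),
    lintegral_unif_floor hN fun i => s.indicator 1 (x i)]
  simp only [empirical, Measure.smul_apply, Measure.finsetSum_apply, Measure.dirac_apply' _ hs,
    smul_eq_mul]
  rw [Finset.sum_range]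

lemma lintegral_unif_reflect (F : ℝ → ℝ≥0∞) : ∫⁻ w, F (1 - w) ∂unif = ∫⁻ w, F w ∂unif := by
  have := (Measure.measurePreserving_sub_left (volume : Measure ℝ) 1).setLIntegral_comp_preimage_emb
    (MeasurableEquiv.subLeft (1 : ℝ)).measurableEmbedding F (Set.Ioo 0 1)
  simpa using this

end Partition

/-! ### Difference quotients inside the shrinking cell around a point. -/

section Derivative

lemma abs_floor_add_div_sub_le {N : ℕ} (hN : 0 < N) {u w : ℝ} (hu : 0 ≤ u)
    (hw : w ∈ Set.Icc (0 : ℝ) 1) : |(⌊(N : ℝ) * u⌋₊ + w) / N - u| ≤ 1 / N := by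
  have hN' : (0 : ℝ) < N := by exact_mod_cast hN
  have h1 := Nat.floor_le (mul_nonneg hN'.le hu)
  have h2 := Nat.lt_floor_add_one ((N : ℝ) * u)
  rw [show (⌊(N : ℝ) * u⌋₊ + w) / N - u = (⌊(N : ℝ) * u⌋₊ + w - N * u) / N by field_simp,
    abs_div, abs_of_pos hN']
  gcongr
  rw [abs_le]
  constructor <;> linarith [hw.1, hw.2]

lemma floor_add_div_mem_Ioo {N : ℕ} {u w : ℝ} (hu : u ∈ Set.Ioo (0 : ℝ) 1)
    (hw : w ∈ Set.Ioo (0 : ℝ) 1) (hN : 0 < N) :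
    (⌊(N : ℝ) * u⌋₊ + w) / N ∈ Set.Ioo (0 : ℝ) 1 := by
  have hN' : (0 : ℝ) < N := by exact_mod_cast hN
  have h3 : ⌊(N : ℝ) * u⌋₊ < N := by
    rw [Nat.floor_lt (mul_nonneg hN'.le hu.1.le)]; nlinarith [hu.2]
  have h4 : (⌊(N : ℝ) * u⌋₊ : ℝ) + 1 ≤ N := by exact_mod_cast h3
  refine ⟨div_pos (add_pos_of_nonneg_of_pos (Nat.cast_nonneg _) hw.1) hN', ?_⟩
  rw [div_lt_one hN']
  linarith [hw.2]

lemma tendsto_floor_add_div {u w : ℝ} (hu : 0 ≤ u) (hw : w ∈ Set.Icc (0 : ℝ) 1) :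
    Tendsto (fun N : ℕ => (⌊(N : ℝ) * u⌋₊ + w) / N) atTop (𝓝 u) := by
  rw [tendsto_iff_norm_sub_tendsto_zero]
  refine squeeze_zero' (Eventually.of_forall fun _ => norm_nonneg _) ?_
    tendsto_one_div_atTop_nhds_zero_nat
  filter_upwards [eventually_gt_atTop 0] with N hN
  exact abs_floor_add_div_sub_le hN hu hw

lemma tendsto_mul_remainder {q : ℝ → ℝ} {g u w : ℝ} (h : HasDerivAt q g u) (hu : 0 ≤ u)
    (hw : w ∈ Set.Icc (0 : ℝ) 1) :
    Tendsto (fun N : ℕ => (N : ℝ) * (q ((⌊(N : ℝ) * u⌋₊ + w) / N) - q u -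
      ((⌊(N : ℝ) * u⌋₊ + w) / N - u) * g)) atTop (𝓝 0) := by
  have h1 := (hasDerivAt_iff_isLittleO.1 h).comp_tendsto (tendsto_floor_add_div hu hw)
  have h2 : ((fun x' => x' - u) ∘ fun N : ℕ => (⌊(N : ℝ) * u⌋₊ + w) / N) =O[atTop]
      fun N : ℕ => 1 / (N : ℝ) := by
    refine Asymptotics.IsBigO.of_bound 1 ?_
    filter_upwards [eventually_gt_atTop 0] with N hN
    simpa using abs_floor_add_div_sub_le hN hu hw
  have h3 := (h1.trans_isBigO h2).tendsto_div_nhds_zero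
  refine h3.congr fun N => ?_
  simp only [Function.comp, smul_eq_mul, div_div_eq_mul_div, div_one]
  ring

/-- The two points need not straddle u: both lie within 1/N of it, so each first-order remainder at
u is o(1/N). -/
lemma tendsto_mul_sub_of_hasDerivAt {q : ℝ → ℝ} {g u a b : ℝ} (h : HasDerivAt q g u) (hu : 0 ≤ u)
    (ha : a ∈ Set.Icc (0 : ℝ) 1) (hb : b ∈ Set.Icc (0 : ℝ) 1) :
    Tendsto (fun N : ℕ => (N : ℝ) * (q ((⌊(N : ℝ) * u⌋₊ + a) / N) -
      q ((⌊(N : ℝ) * u⌋₊ + b) / N))) atTop (𝓝 ((a - b) * g)) := by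
  have h1 := ((tendsto_mul_remainder h hu ha).sub (tendsto_mul_remainder h hu hb)).add_const
    ((a - b) * g)
  simp only [sub_zero, zero_add] at h1
  refine h1.congr' ?_
  filter_upwards [eventually_gt_atTop 0] with N hN
  have hN' : (N : ℝ) ≠ 0 := by exact_mod_cast hN.ne'
  field_simp
  ring

end Derivative

/-! ### Optimality of the monotone coupling. -/

section Duality

lemma convexOn_abs_rpow {ρ : ℝ} (hρ : 1 ≤ ρ) : ConvexOn ℝ Set.univ fun x : ℝ => |x| ^ ρ := by
  refine ⟨convex_univ, fun x _ y _ a b ha hb hab => ?_⟩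
  have h1 : |a • x + b • y| ≤ a • |x| + b • |y| := by
    refine (abs_add_le _ _).trans (le_of_eq ?_)
    simp [abs_mul, abs_of_nonneg ha, abs_of_nonneg hb]
  exact (Real.rpow_le_rpow (abs_nonneg _) h1 (by linarith)).trans
    ((convexOn_rpow hρ).2 (abs_nonneg x) (abs_nonneg y) ha hb hab)

/-- p and p' are convex combinations of r and s with swapped weights. -/
lemma ConvexOn.add_le_add_of_mem_Icc {h : ℝ → ℝ} (hh : ConvexOn ℝ Set.univ h) {r s p p' : ℝ}
    (hr : r ≤ p) (hs : p ≤ s) (hsum : p + p' = r + s) : h p + h p' ≤ h r + h s := by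
  rcases (hr.trans hs).eq_or_lt with rfl | hlt
  · obtain rfl : p = r := le_antisymm hs hr
    obtain rfl : p' = p := by linarith
    rfl
  have hd : 0 < s - r := sub_pos.2 hlt
  have hne : s - r ≠ 0 := hd.ne'
  have ha : 0 ≤ (s - p) / (s - r) := div_nonneg (by linarith) hd.le
  have hb : 0 ≤ (p - r) / (s - r) := div_nonneg (by linarith) hd.le
  have hab : (s - p) / (s - r) + (p - r) / (s - r) = 1 := by field_simp; ring
  have h1 := hh.2 (Set.mem_univ r) (Set.mem_univ s) ha hb hab
  have h2 := hh.2 (Set.mem_univ r) (Set.mem_univ s) hb ha (by rw [add_comm]; exact hab)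
  have e1 : ((s - p) / (s - r)) • r + ((p - r) / (s - r)) • s = p := by
    simp only [smul_eq_mul]; field_simp; ring
  have e2 : ((p - r) / (s - r)) • r + ((s - p) / (s - r)) • s = p' := by
    rw [show p' = r + s - p by linarith]; simp only [smul_eq_mul]; field_simp; ring
  rw [e1] at h1
  rw [e2] at h2
  simp only [smul_eq_mul] at h1 h2
  have : h r + h s = ((s - p) / (s - r) + (p - r) / (s - r)) * (h r + h s) := by rw [hab, one_mul]
  linarith

lemma abs_rpow_exchange {ρ : ℝ} (hρ : 1 ≤ ρ) {a b y z : ℝ} (hab : a ≤ b) (hyz : y ≤ z) :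
    |b - z| ^ ρ + |a - y| ^ ρ ≤ |b - y| ^ ρ + |a - z| ^ ρ := by
  have := ConvexOn.add_le_add_of_mem_Icc (convexOn_abs_rpow hρ) (r := a - z) (s := b - y)
    (p := b - z) (p' := a - y) (by linarith) (by linarith) (by ring)
  linarith

/-- The Kantorovich potential at the `j`-th point of the sequence `x`, when the mass transported
to `x k` and the mass transported to `x (k + 1)` are separated by the point `t (k + 1)`. -/
noncomputable def potential (ρ : ℝ) (x t : ℕ → ℝ) (j : ℕ) : ℝ :=
  ∑ k ∈ Finset.range j, (|x (k + 1) - t (k + 1)| ^ ρ - |x k - t (k + 1)| ^ ρ)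

lemma potential_succ (ρ : ℝ) (x t : ℕ → ℝ) (j : ℕ) : potential ρ x t (j + 1) =
    potential ρ x t j + (|x (j + 1) - t (j + 1)| ^ ρ - |x j - t (j + 1)| ^ ρ) :=
  Finset.sum_range_succ _ _

/-- By the exchange inequality, passing from k to k + 1 raises cost minus potential when y ≤ t (k +
1) and lowers it when y ≥ t (k + 1). Hence the minimum over the indices is at the j whose thresholds
enclose y. -/
lemma cost_sub_potential_le {ρ : ℝ} (hρ : 1 ≤ ρ) {N : ℕ} {x t : ℕ → ℝ}
    (hx : ∀ i j, i ≤ j → j < N → x i ≤ x j) {j : ℕ} (hj : j < N) {y : ℝ}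
    (ht1 : ∀ k < j, t (k + 1) ≤ y) (ht2 : ∀ k, j ≤ k → k + 1 < N → y ≤ t (k + 1))
    {i : ℕ} (hi : i < N) :
    |x j - y| ^ ρ - potential ρ x t j ≤ |x i - y| ^ ρ - potential ρ x t i := by
  rcases le_total j i with hji | hij
  · induction i, hji using Nat.le_induction with
    | base => rfl
    | succ k hk ih =>
      refine (ih (by omega)).trans ?_
      rw [potential_succ]
      have := abs_rpow_exchange hρ (hx k (k + 1) (by omega) hi) (ht2 k hk hi)
      linarith
  · induction j, hij using Nat.le_induction with
    | base => rfl
    | succ k hk ih =>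
      have hy := ht1 k (by omega)
      have h1 : |x (k + 1) - y| ^ ρ - potential ρ x t (k + 1) ≤
          |x k - y| ^ ρ - potential ρ x t k := by
        rw [potential_succ]
        have := abs_rpow_exchange hρ (hx k (k + 1) (by omega) hj) hy
        linarith
      have h2 : ∀ m, i ≤ m → m ≤ k →
          |x k - y| ^ ρ - potential ρ x t k ≤ |x m - y| ^ ρ - potential ρ x t m := by
        intro m _ hmk
        induction hmk using Nat.decreasingInduction with
        | self => rfl
        | of_succ m hmk ihm =>
          refine (ihm (by omega)).trans ?_
          rw [potential_succ]
          have := abs_rpow_exchange hρ (hx m (m + 1) (by omega) (by omega)) (ht1 m (by omega))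
          linarith
      exact h1.trans (h2 i le_rfl hk)

/-- A continuous function interpolating the potentials at the points `x i`. -/
noncomputable def potentialFun (ρ : ℝ) (N : ℕ) (x t : ℕ → ℝ) (z : ℝ) : ℝ :=
  ∑ k ∈ Finset.range (N - 1),
    (|max (x k) (min z (x (k + 1))) - t (k + 1)| ^ ρ - |x k - t (k + 1)| ^ ρ)

lemma measurable_potentialFun (ρ : ℝ) (N : ℕ) (x t : ℕ → ℝ) :
    Measurable (potentialFun ρ N x t) := by
  unfold potentialFun
  fun_prop

/-- At x i the clamp saturates at x (k + 1) for k < i and at x k for k ≥ i, where the summand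
vanishes. This survives repeated points, so the potential is a function of the point and not only of
its index, as a coupling requires. -/
lemma potentialFun_apply (ρ : ℝ) {N : ℕ} {x : ℕ → ℝ} (t : ℕ → ℝ)
    (hx : ∀ i j, i ≤ j → j < N → x i ≤ x j) {i : ℕ} (hi : i < N) :
    potentialFun ρ N x t (x i) = potential ρ x t i := by
  have hsub : Finset.range i ⊆ Finset.range (N - 1) := Finset.range_subset_range.2 (by omega)
  unfold potentialFun potential
  rw [← Finset.sum_subset hsub]
  · refine Finset.sum_congr rfl fun k hk => ?_
    have hk' := Finset.mem_range.1 hk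
    rw [min_eq_right (hx (k + 1) i (by omega) hi), max_eq_right (hx k (k + 1) (by omega) (by omega))]
  · intro k hk hk'
    have h1 := Finset.mem_range.1 hk
    have h2 := not_lt.1 (fun h => hk' (Finset.mem_range.2 h))
    rw [min_eq_left (hx i (k + 1) (by omega) (by omega)), max_eq_left (hx i k h2 (by omega)), sub_self]

lemma floor_mul_lt {N : ℕ} (hN : 0 < N) {u : ℝ} (hu : u ∈ Set.Ioo (0 : ℝ) 1) :
    ⌊(N : ℝ) * u⌋₊ < N := by
  have hN' : (0 : ℝ) < N := by exact_mod_cast hN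
  rw [Nat.floor_lt (mul_nonneg hN'.le hu.1.le)]
  nlinarith [hu.2]

lemma cost_sub_potential_quantile_le {ρ : ℝ} (hρ : 1 ≤ ρ) (μ : Measure ℝ) {N : ℕ} (hN : 0 < N)
    {x : ℕ → ℝ} (hx : ∀ i j, i ≤ j → j < N → x i ≤ x j) {u : ℝ} (hu : u ∈ Set.Ioo (0 : ℝ) 1)
    {i : ℕ} (hi : i < N) :
    |x ⌊(N : ℝ) * u⌋₊ - quantile μ u| ^ ρ -
        potential ρ x (fun k => quantile μ (k / N)) ⌊(N : ℝ) * u⌋₊ ≤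
      |x i - quantile μ u| ^ ρ - potential ρ x (fun k => quantile μ (k / N)) i := by
  have hN' : (0 : ℝ) < N := by exact_mod_cast hN
  have h1 := Nat.floor_le (mul_nonneg hN'.le hu.1.le)
  have h2 := Nat.lt_floor_add_one ((N : ℝ) * u)
  have hlt := floor_mul_lt hN hu
  have hmem : ∀ k : ℕ, k + 1 < N → ((k + 1 : ℕ) : ℝ) / N ∈ Set.Ioo (0 : ℝ) 1 := fun k hk =>
    ⟨by positivity, by rw [div_lt_one hN']; exact_mod_cast hk⟩
  refine cost_sub_potential_le hρ hx hlt ?_ ?_ hi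
  · intro k hk
    refine monotoneOn_quantile μ (hmem k (by omega)) hu ?_
    rw [div_le_iff₀ hN', mul_comm]
    refine le_trans ?_ h1
    exact_mod_cast hk
  · intro k hk hkN
    refine monotoneOn_quantile μ hu (hmem k hkN) ?_
    rw [le_div_iff₀ hN', mul_comm]
    refine h2.le.trans ?_
    exact_mod_cast Nat.succ_le_succ hk

/-- Weak duality: the dual function `Ψ` has the same integral under every coupling; it dominates
cost plus shifted potential along the monotone coupling and is dominated by it along `π`. The
potential terms share the finite integral `S`, which cancels even if the costs are infinite. -/
lemma lintegral_quantile_le_of_coupling {ρ : ℝ} (hρ : 1 ≤ ρ) (μ : Measure ℝ)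
    [IsProbabilityMeasure μ] {N : ℕ} (hN : 0 < N) {x : ℕ → ℝ}
    (hx : ∀ i j, i ≤ j → j < N → x i ≤ x j) (π : Measure (ℝ × ℝ))
    (h1 : π.map Prod.fst = empirical fun i : Fin N => x i) (h2 : π.map Prod.snd = μ) :
    ∫⁻ u, ENNReal.ofReal (|x ⌊(N : ℝ) * u⌋₊ - quantile μ u| ^ ρ) ∂unif ≤
      ∫⁻ p, ENNReal.ofReal (|p.1 - p.2| ^ ρ) ∂π := by
  set t : ℕ → ℝ := fun k => quantile μ (k / N) with ht
  set φ : ℕ → ℝ := potential ρ x t with hφ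
  set Φ : ℝ → ℝ := potentialFun ρ N x t with hΦ
  have hΦm : Measurable Φ := measurable_potentialFun ρ N x t
  -- The shift by `B` makes the potential terms nonnegative, so that all integrals can be taken in
  -- [0, ∞].
  obtain ⟨B, hB⟩ : ∃ B, ∀ i < N, φ i ≤ B :=
    ⟨∑ i ∈ Finset.range N, |φ i|, fun i hi => (le_abs_self _).trans
      (Finset.single_le_sum (f := fun i => |φ i|) (fun _ _ => abs_nonneg _)
        (Finset.mem_range.2 hi))⟩
  set Ψ : ℝ → ℝ≥0∞ := fun y => ⨅ i ∈ Finset.range N,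
    ENNReal.ofReal (|x i - y| ^ ρ + (B - φ i)) with hΨ
  have hΨm : Measurable Ψ := Measurable.iInf fun i => Measurable.iInf fun _ => by fun_prop
  have hfloor := map_unif_floor hN x
  set S := ∫⁻ u, ENNReal.ofReal (B - φ ⌊(N : ℝ) * u⌋₊) ∂unif with hS
  have hSfin : S ≠ ∞ := by
    rw [hS, lintegral_unif_floor hN fun i => ENNReal.ofReal (B - φ i)]
    refine ENNReal.mul_ne_top (by simp [hN.ne']) ?_
    simp
  have hSπ : ∫⁻ p, ENNReal.ofReal (B - Φ p.1) ∂π = S := by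
    have hm : Measurable fun z => ENNReal.ofReal (B - Φ z) := by fun_prop
    rw [← lintegral_map (f := fun z => ENNReal.ofReal (B - Φ z)) hm measurable_fst, h1, ← hfloor,
      lintegral_map hm (measurable_comp_floor_mul N x)]
    refine setLIntegral_congr_fun measurableSet_Ioo fun u hu => ?_
    simp only [hΦ, potentialFun_apply ρ t hx (floor_mul_lt hN hu), hφ]
  have hΨπ : ∫⁻ p, Ψ p.2 ∂π = ∫⁻ u, Ψ (quantile μ u) ∂unif := by
    rw [← lintegral_map hΨm measurable_snd, h2]
    conv_lhs => rw [← map_quantile μ]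
    rw [lintegral_map hΨm (measurable_quantile μ)]
  have hmem : ∀ᵐ p ∂π, p.1 ∈ (Finset.range N).image x := by
    have hs : MeasurableSet {z | z ∈ (Finset.range N).image x} :=
      ((Finset.range N).image x).measurableSet
    have : ∀ᵐ z ∂(π.map Prod.fst), z ∈ (Finset.range N).image x := by
      rw [h1, ← hfloor, ae_map_iff (measurable_comp_floor_mul N x).aemeasurable hs]
      filter_upwards [ae_restrict_mem measurableSet_Ioo] with u hu
      exact Finset.mem_image_of_mem _ (Finset.mem_range.2 (floor_mul_lt hN hu))
    exact ae_of_ae_map measurable_fst.aemeasurable this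
  have hlow : ∫⁻ u, ENNReal.ofReal (|x ⌊(N : ℝ) * u⌋₊ - quantile μ u| ^ ρ) ∂unif + S ≤
      ∫⁻ u, Ψ (quantile μ u) ∂unif := by
    rw [hS, ← lintegral_add_right _ (measurable_comp_floor_mul N
      fun i => ENNReal.ofReal (B - φ i))]
    refine setLIntegral_mono_ae' measurableSet_Ioo (Eventually.of_forall fun u hu => ?_)
    refine le_iInf₂ fun i hi => ?_
    rw [← ENNReal.ofReal_add (by positivity) (sub_nonneg.2 (hB _ (floor_mul_lt hN hu)))]
    refine ENNReal.ofReal_le_ofReal ?_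
    have := cost_sub_potential_quantile_le hρ μ hN hx hu (Finset.mem_range.1 hi)
    linarith
  have hup : ∫⁻ p, Ψ p.2 ∂π ≤ ∫⁻ p, ENNReal.ofReal (|p.1 - p.2| ^ ρ) ∂π + S := by
    rw [← hSπ, ← lintegral_add_right _ (by fun_prop)]
    refine lintegral_mono_ae ?_
    filter_upwards [hmem] with p hp
    obtain ⟨i, hi, hip⟩ := Finset.mem_image.1 hp
    have hi' := Finset.mem_range.1 hi
    refine (iInf₂_le i hi).trans ?_
    rw [← hip, hΦ, potentialFun_apply ρ t hx hi',
      ← ENNReal.ofReal_add (by positivity) (sub_nonneg.2 (hB i hi'))]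
  rw [← hΨπ] at hlow
  exact (ENNReal.add_le_add_iff_right hSfin).1 (hlow.trans hup)

lemma wasserstein_empirical {ρ : ℝ} (hρ : 1 ≤ ρ) (μ : Measure ℝ)
    [IsProbabilityMeasure μ] {N : ℕ} (hN : 0 < N) {x : ℕ → ℝ}
    (hx : ∀ i j, i ≤ j → j < N → x i ≤ x j) :
    wasserstein ρ (empirical fun i : Fin N => x i) μ =
      (∫⁻ u, ENNReal.ofReal (|x ⌊(N : ℝ) * u⌋₊ - quantile μ u| ^ ρ) ∂unif) ^ (1 / ρ) := by
  unfold wasserstein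
  congr 1
  apply le_antisymm
  · have hm : Measurable fun u : ℝ => (x ⌊(N : ℝ) * u⌋₊, quantile μ u) :=
      (measurable_comp_floor_mul N x).prodMk (measurable_quantile μ)
    refine iInf_le_of_le (unif.map fun u => (x ⌊(N : ℝ) * u⌋₊, quantile μ u)) ?_
    refine iInf₂_le_of_le ?_ ?_ ?_
    · rw [Measure.map_map measurable_fst hm]
      exact map_unif_floor hN x
    · rw [Measure.map_map measurable_snd hm]
      exact map_quantile μ
    · rw [lintegral_map (by fun_prop) hm]
  · exact le_iInf fun π => le_iInf₂ fun h1 h2 => lintegral_quantile_le_of_coupling hρ μ hN hx π h1 h2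

end Duality

/-! ### The moments of |w - 1/2|. -/

section Constant

lemma intervalIntegral_abs_sub_half_rpow {s : ℝ} (hs : 0 ≤ s) :
    ∫ w in (0 : ℝ)..1, |w - 1 / 2| ^ s = 1 / (2 ^ s * (s + 1)) := by
  have hc : Continuous fun x : ℝ => |x| ^ s := continuous_abs.rpow_const fun _ => Or.inr hs
  have h1 : ∫ x in (0 : ℝ)..(1 / 2), |x| ^ s = (1 / 2) ^ (s + 1) / (s + 1) := by
    rw [intervalIntegral.integral_congr (g := fun x => x ^ s), integral_rpow (Or.inl (by linarith)),
      Real.zero_rpow (by linarith), sub_zero]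
    intro x hx
    rw [Set.uIcc_of_le (by norm_num)] at hx
    simp only [abs_of_nonneg hx.1]
  have h2 : ∫ x in (-(1 / 2) : ℝ)..0, |x| ^ s = (1 / 2) ^ (s + 1) / (s + 1) := by
    rw [← h1]
    have := intervalIntegral.integral_comp_neg (a := (0 : ℝ)) (b := 1 / 2) (fun x : ℝ => |x| ^ s)
    simp only [abs_neg, neg_zero] at this
    exact this.symm
  rw [intervalIntegral.integral_comp_sub_right (fun x => |x| ^ s) (1 / 2)]
  rw [show (0 : ℝ) - 1 / 2 = -(1 / 2) by norm_num, show (1 : ℝ) - 1 / 2 = 1 / 2 by norm_num,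
    ← intervalIntegral.integral_add_adjacent_intervals (hc.intervalIntegrable _ 0)
      (hc.intervalIntegrable _ _), h1, h2, Real.rpow_add_one (by norm_num),
    Real.div_rpow (by norm_num) (by norm_num), Real.one_rpow]
  have : (2 : ℝ) ^ s ≠ 0 := (Real.rpow_pos_of_pos (by norm_num) s).ne'
  field_simp
  norm_num

lemma lintegral_abs_sub_half_rpow {s : ℝ} (hs : 0 ≤ s) :
    ∫⁻ w, ENNReal.ofReal (|w - 1 / 2| ^ s) ∂unif = ENNReal.ofReal (1 / (2 ^ s * (s + 1))) := by
  have hc : Continuous fun x : ℝ => |x - 1 / 2| ^ s := by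
    fun_prop (disch := exact fun _ => Or.inr hs)
  rw [← intervalIntegral_abs_sub_half_rpow hs, intervalIntegral.integral_of_le zero_le_one,
    ofReal_integral_eq_lintegral_ofReal, ← restrict_Ioo_eq_restrict_Ioc]
  · exact ((intervalIntegrable_iff_integrableOn_Ioc_of_le zero_le_one).1
      (hc.intervalIntegrable 0 1))
  · exact Eventually.of_forall fun _ => by positivity

end Constant

/-! ### The lower bound, by reflection in the cells and Fatou. -/

section Lower

/-- Symmetrised rescaled cost: each cell is reflected about its midpoint. -/
noncomputable def symmCost (ρ : ℝ) (μ : Measure ℝ) (N : ℕ) (u w : ℝ) : ℝ≥0∞ :=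
  ENNReal.ofReal ((|(N : ℝ) * (quantile μ ((⌊(N : ℝ) * u⌋₊ + w) / N) -
    quantile μ ((⌊(N : ℝ) * u⌋₊ + (1 - w)) / N))| / 2) ^ ρ)

lemma measurable_symmCost (ρ : ℝ) (μ : Measure ℝ) (N : ℕ) :
    Measurable fun p : ℝ × ℝ => symmCost ρ μ N p.1 p.2 := by
  have hq := measurable_quantile μ
  have hfl : Measurable fun p : ℝ × ℝ => (⌊(N : ℝ) * p.1⌋₊ : ℝ) :=
    (measurable_comp_floor_mul N fun k => (k : ℝ)).comp measurable_fst
  unfold symmCost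
  fun_prop

/-- n (a - b) / 2 is the midpoint of n (a - x) and n (x - b), so convexity eliminates x. -/
lemma two_mul_half_rpow_le {ρ : ℝ} (hρ : 1 ≤ ρ) {n : ℝ} (hn : 0 ≤ n) (x a b : ℝ) :
    2 * (|n * (a - b)| / 2) ^ ρ ≤ n ^ ρ * |x - a| ^ ρ + n ^ ρ * |x - b| ^ ρ := by
  have h := (convexOn_abs_rpow hρ).2 (Set.mem_univ (n * (a - x))) (Set.mem_univ (n * (x - b)))
    (by norm_num : (0 : ℝ) ≤ 1 / 2) (by norm_num : (0 : ℝ) ≤ 1 / 2) (by norm_num)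
  have e : (1 / 2 : ℝ) • (n * (a - x)) + (1 / 2 : ℝ) • (n * (x - b)) = n * (a - b) / 2 := by
    simp only [smul_eq_mul]; ring
  simp only [e, abs_div, abs_two] at h
  rw [abs_mul n (a - x), abs_mul n (x - b), abs_of_nonneg hn, abs_sub_comm a x,
    Real.mul_rpow hn (abs_nonneg _), Real.mul_rpow hn (abs_nonneg _)] at h
  simp only [smul_eq_mul] at h
  linarith

lemma lintegral_le_of_symm {h k : ℝ → ℝ≥0∞} (hm : Measurable h)
    (hk : ∀ w ∈ Set.Ioo (0 : ℝ) 1, 2 * k w ≤ h w + h (1 - w)) :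
    ∫⁻ w, k w ∂unif ≤ ∫⁻ w, h w ∂unif := by
  have h1 : ∫⁻ w, 2 * k w ∂unif ≤ ∫⁻ w, h w + h (1 - w) ∂unif :=
    setLIntegral_mono_ae' measurableSet_Ioo (Eventually.of_forall hk)
  rw [lintegral_add_left hm, lintegral_unif_reflect h, lintegral_const_mul' _ _ (by simp),
    ← two_mul] at h1
  exact (ENNReal.mul_le_mul_iff_right (by simp) (by simp)).1 h1

lemma lintegral_symmCost_le {ρ : ℝ} (hρ : 1 ≤ ρ) (μ : Measure ℝ) {N : ℕ} (hN : 0 < N)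
    (x : ℕ → ℝ) :
    ∫⁻ u, ∫⁻ w, symmCost ρ μ N u w ∂unif ∂unif ≤
      (N : ℝ≥0∞) ^ ρ *
        ∫⁻ u, ENNReal.ofReal (|x ⌊(N : ℝ) * u⌋₊ - quantile μ u| ^ ρ) ∂unif := by
  have hρ0 : 0 ≤ ρ := by linarith
  have hq := measurable_quantile μ
  have hN' : (0 : ℝ) ≤ N := Nat.cast_nonneg N
  have hcast : (N : ℝ≥0∞) ^ ρ = ENNReal.ofReal ((N : ℝ) ^ ρ) := by
    rw [← ENNReal.ofReal_rpow_of_nonneg hN' hρ0, ENNReal.ofReal_natCast]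
  rw [← lintegral_const_mul' _ _ (by rw [hcast]; exact ENNReal.ofReal_ne_top),
    lintegral_unif_phase hN fun u =>
      (N : ℝ≥0∞) ^ ρ * ENNReal.ofReal (|x ⌊(N : ℝ) * u⌋₊ - quantile μ u| ^ ρ)]
  refine lintegral_mono fun u => ?_
  refine (lintegral_le_of_symm (h := fun w => (N : ℝ≥0∞) ^ ρ * ENNReal.ofReal
    (|x ⌊(N : ℝ) * u⌋₊ - quantile μ ((⌊(N : ℝ) * u⌋₊ + w) / N)| ^ ρ)) (by fun_prop) ?_).trans
    (le_of_eq ?_)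
  · intro w _
    rw [hcast, symmCost, ← ENNReal.ofReal_mul (by positivity), ← ENNReal.ofReal_mul (by positivity),
      ← ENNReal.ofReal_add (by positivity) (by positivity),
      show (2 : ℝ≥0∞) = ENNReal.ofReal 2 by simp, ← ENNReal.ofReal_mul (by norm_num)]
    exact ENNReal.ofReal_le_ofReal (two_mul_half_rpow_le hρ hN' _ _ _)
  · refine setLIntegral_congr_fun measurableSet_Ioo fun w hw => ?_
    simp only [floor_mul_div hN _ hw]

lemma lintegral_symmCost_rpow_le_minError {ρ : ℝ} (hρ : 1 ≤ ρ) (μ : Measure ℝ)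
    [IsProbabilityMeasure μ] {N : ℕ} (hN : 0 < N) :
    (∫⁻ u, ∫⁻ w, symmCost ρ μ N u w ∂unif ∂unif) ^ (1 / ρ) ≤ (N : ℝ≥0∞) * minError N μ ρ := by
  have hρ0 : 0 < ρ := by linarith
  unfold minError
  rw [ENNReal.mul_iInf_of_ne (by simp [hN.ne']) (by simp)]
  refine le_iInf fun x => ?_
  rw [ENNReal.mul_iInf_of_ne (by simp [hN.ne']) (by simp)]
  refine le_iInf fun hx => ?_
  -- The value 0 beyond N is arbitrary: only indices below N are ever reached.
  set y : ℕ → ℝ := fun k => if h : k < N then x ⟨k, h⟩ else 0 with hy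
  have hxy : x = fun i : Fin N => y i := by ext i; simp [hy]
  have hmono : ∀ i j, i ≤ j → j < N → y i ≤ y j := fun i j hij hj => by
    simp only [hy, hj, hij.trans_lt hj, dif_pos]
    exact hx hij
  rw [hxy, wasserstein_empirical hρ μ hN hmono]
  calc _ ≤ ((N : ℝ≥0∞) ^ ρ *
        ∫⁻ u, ENNReal.ofReal (|y ⌊(N : ℝ) * u⌋₊ - quantile μ u| ^ ρ) ∂unif) ^ (1 / ρ) :=
        ENNReal.rpow_le_rpow (lintegral_symmCost_le hρ μ hN y) (by positivity)
    _ = _ := by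
        rw [ENNReal.mul_rpow_of_nonneg _ _ (by positivity), ← ENNReal.rpow_mul,
          mul_one_div_cancel hρ0.ne', ENNReal.rpow_one]

lemma tendsto_symmCost {ρ : ℝ} (hρ : 1 ≤ ρ) {μ : Measure ℝ} {u g w : ℝ}
    (hu : u ∈ Set.Ioo (0 : ℝ) 1) (hg : HasDerivAt (quantile μ) g u) (hw : w ∈ Set.Ioo (0 : ℝ) 1) :
    Tendsto (fun N => symmCost ρ μ N u w) atTop
      (𝓝 (ENNReal.ofReal (|g| ^ ρ) * ENNReal.ofReal (|w - 1 / 2| ^ ρ))) := by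
  have hρ0 : 0 ≤ ρ := by linarith
  have h := tendsto_mul_sub_of_hasDerivAt hg hu.1.le (Set.Ioo_subset_Icc_self hw)
    (b := 1 - w) ⟨by linarith [hw.2], by linarith [hw.1]⟩
  have h2 := ENNReal.tendsto_ofReal (((h.abs.div_const 2).rpow_const (p := ρ) (Or.inr hρ0)))
  have e : |(w - (1 - w)) * g| / 2 = |g| * |w - 1 / 2| := by
    rw [show (w - (1 - w)) * g = g * (w - 1 / 2) * 2 by ring, abs_mul _ (2 : ℝ), abs_mul, abs_two]
    ring
  rw [e, Real.mul_rpow (abs_nonneg _) (abs_nonneg _), ENNReal.ofReal_mul (by positivity)] at h2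
  exact h2

/-- The integrand of `densityIntegral`. -/
noncomputable def densityRpow (μ : Measure ℝ) (A : Set ℝ) (f : ℝ → ℝ) (ρ u : ℝ) : ℝ≥0∞ :=
  A.indicator (fun _ => (1 : ℝ≥0∞)) (quantile μ u) / ENNReal.ofReal (f (quantile μ u) ^ ρ)

lemma densityIntegral_eq (μ : Measure ℝ) (A : Set ℝ) (f : ℝ → ℝ) (ρ : ℝ) :
    densityIntegral μ A f ρ = ∫⁻ u, densityRpow μ A f ρ u ∂unif := rfl

/-- Only an inequality, since the quantile may have a positive derivative where its value is outside
`A`. -/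
lemma densityRpow_le {μ : Measure ℝ} {A : Set ℝ} {f : ℝ → ℝ} {ρ u g : ℝ}
    (hf0 : ∀ x, 0 ≤ f x) (hg : quantile μ u ∈ A → g * f (quantile μ u) = 1) :
    densityRpow μ A f ρ u ≤ ENNReal.ofReal (|g| ^ ρ) := by
  unfold densityRpow
  by_cases hA : quantile μ u ∈ A
  · have h := hg hA
    have hfp : 0 < f (quantile μ u) :=
      (hf0 _).lt_of_ne' fun h0 => by rw [h0, mul_zero] at h; exact zero_ne_one h
    have hgp : g = (f (quantile μ u))⁻¹ := eq_inv_of_mul_eq_one_left h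
    rw [Set.indicator_of_mem hA, one_div, ← ENNReal.ofReal_inv_of_pos (by positivity), hgp,
      abs_of_pos (by positivity), Real.inv_rpow hfp.le]
  · rw [Set.indicator_of_notMem hA, ENNReal.zero_div]
    exact zero_le

lemma lintegral_lintegral_liminf_le {α β : Type*} [MeasurableSpace α] [MeasurableSpace β]
    (ν : Measure α) (η : Measure β) [SFinite η] {k : ℕ → α → β → ℝ≥0∞}
    (hk : ∀ N, Measurable (Function.uncurry (k N))) :
    ∫⁻ u, ∫⁻ w, liminf (fun N => k N u w) atTop ∂η ∂ν ≤
      liminf (fun N => ∫⁻ u, ∫⁻ w, k N u w ∂η ∂ν) atTop := by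
  have h1 : ∀ u, ∫⁻ w, liminf (fun N => k N u w) atTop ∂η ≤
      liminf (fun N => ∫⁻ w, k N u w ∂η) atTop := fun u =>
    lintegral_liminf_le fun N => (hk N).of_uncurry_left
  have h2 : ∀ N, Measurable fun u => ∫⁻ w, k N u w ∂η := fun N => (hk N).lintegral_prod_right
  exact (lintegral_mono h1).trans (lintegral_liminf_le h2)

lemma mul_densityIntegral_le_liminf {ρ : ℝ} (hρ : 1 ≤ ρ) {μ μsing : Measure ℝ}
    [IsProbabilityMeasure μ] {f : ℝ → ℝ} (hf : Measurable f) (hf0 : ∀ x, 0 ≤ f x)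
    (hμ : μ = volume.withDensity (fun x => ENNReal.ofReal (f x)) + μsing)
    {A : Set ℝ} (hA : MeasurableSet A) (hAsing : μsing A = 0) (hAvol : volume Aᶜ = 0) :
    ENNReal.ofReal (1 / (2 ^ ρ * (ρ + 1))) * densityIntegral μ A f ρ ≤
      liminf (fun N : ℕ => ∫⁻ u, ∫⁻ w, symmCost ρ μ N u w ∂unif ∂unif) atTop := by
  have h1 : ∫⁻ u, ENNReal.ofReal (1 / (2 ^ ρ * (ρ + 1))) * densityRpow μ A f ρ u ∂unif ≤
      ∫⁻ u, ∫⁻ w, liminf (fun N => symmCost ρ μ N u w) atTop ∂unif ∂unif := by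
    refine lintegral_mono_ae ?_
    filter_upwards [ae_hasDerivAt_quantile hf hf0 hμ hA hAsing hAvol] with u hu
    obtain ⟨hu, g, hg, hgA⟩ := hu
    have hlim : ∫⁻ w, liminf (fun N => symmCost ρ μ N u w) atTop ∂unif =
        ∫⁻ w, ENNReal.ofReal (|g| ^ ρ) * ENNReal.ofReal (|w - 1 / 2| ^ ρ) ∂unif :=
      setLIntegral_congr_fun measurableSet_Ioo
        fun w hw => (tendsto_symmCost hρ hu hg hw).liminf_eq
    rw [hlim, lintegral_const_mul' _ _ ENNReal.ofReal_ne_top,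
      lintegral_abs_sub_half_rpow (by linarith), mul_comm]
    exact mul_le_mul_left (densityRpow_le hf0 hgA) _
  have h2 := lintegral_lintegral_liminf_le unif unif (k := symmCost ρ μ)
    (measurable_symmCost ρ μ)
  rw [lintegral_const_mul' _ _ ENNReal.ofReal_ne_top, ← densityIntegral_eq] at h1
  exact h1.trans h2

lemma ENNReal.rpow_liminf {α : Type*} {l : Filter α} (F : α → ℝ≥0∞) {s : ℝ} (hs : 0 < s) :
    (liminf F l) ^ s = liminf (fun a => F a ^ s) l :=
  (ENNReal.orderIsoRpow s hs).liminf_apply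

/-- Used with c = ρ + 1 for the limit and c = ρ for the uniform bound. -/
lemma constant_rpow {ρ c : ℝ} (hρ : 1 ≤ ρ) (hc : 0 ≤ c) (I : ℝ≥0∞) :
    (ENNReal.ofReal (1 / (2 ^ ρ * c)) * I) ^ (1 / ρ) =
      ENNReal.ofReal (1 / (2 * c ^ (1 / ρ))) * I ^ (1 / ρ) := by
  have hρ0 : 0 < ρ := by linarith
  rw [ENNReal.mul_rpow_of_nonneg _ _ (by positivity),
    ENNReal.ofReal_rpow_of_nonneg (by positivity) (by positivity),
    Real.div_rpow (by positivity) (by positivity), Real.one_rpow,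
    Real.mul_rpow (by positivity) hc, ← Real.rpow_mul (by norm_num), mul_one_div_cancel hρ0.ne',
    Real.rpow_one]

theorem le_liminf_minError {ρ : ℝ} (hρ : 1 ≤ ρ) {μ μsing : Measure ℝ}
    [IsProbabilityMeasure μ] {f : ℝ → ℝ} (hf : Measurable f) (hf0 : ∀ x, 0 ≤ f x)
    (hμ : μ = volume.withDensity (fun x => ENNReal.ofReal (f x)) + μsing)
    {A : Set ℝ} (hA : MeasurableSet A) (hAsing : μsing A = 0) (hAvol : volume Aᶜ = 0) :
    ENNReal.ofReal (1 / (2 * (ρ + 1) ^ (1 / ρ))) * densityIntegral μ A f ρ ^ (1 / ρ) ≤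
      liminf (fun N : ℕ => (N : ℝ≥0∞) * minError N μ ρ) atTop := by
  rw [← constant_rpow hρ (by linarith)]
  refine (ENNReal.rpow_le_rpow (mul_densityIntegral_le_liminf hρ hf hf0 hμ hA hAsing hAvol)
    (by positivity)).trans ?_
  rw [ENNReal.rpow_liminf _ (by positivity)]
  refine liminf_le_liminf ?_
  filter_upwards [eventually_gt_atTop 0] with N hN
  exact lintegral_symmCost_rpow_le_minError hρ μ hN

end Lower

/-! ### Hölder, cell averages and generalised dominated convergence. -/

section General

lemma setLIntegral_rpow_le {ρ : ℝ} (hρ : 1 ≤ ρ) {G : ℝ → ℝ≥0∞} (hG : Measurable G) (s : Set ℝ) :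
    (∫⁻ u in s, G u) ^ ρ ≤ volume s ^ (ρ - 1) * ∫⁻ u in s, G u ^ ρ := by
  have hρ0 : 0 < ρ := by linarith
  have h := eLpNorm'_le_eLpNorm'_mul_rpow_measure_univ (μ := volume.restrict s) (f := G)
    one_pos hρ hG.aestronglyMeasurable
  simp only [eLpNorm'_eq_lintegral_enorm, enorm_eq_self, ENNReal.rpow_one, div_one,
    Measure.restrict_apply_univ] at h
  refine (ENNReal.rpow_le_rpow h hρ0.le).trans (le_of_eq ?_)
  rw [ENNReal.mul_rpow_of_nonneg _ _ hρ0.le, ← ENNReal.rpow_mul, ← ENNReal.rpow_mul,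
    one_div_mul_cancel hρ0.ne', ENNReal.rpow_one, mul_comm]
  congr 2
  field_simp

lemma exists_primitive {Φ : ℝ → ℝ≥0∞} (hΦ : Measurable Φ) (hfin : ∫⁻ u, Φ u ∂unif ≠ ∞) :
    ∃ H : ℝ → ℝ,
      (∀ a b, 0 ≤ a → a ≤ b → b ≤ 1 →
        H a ≤ H b ∧ ∫⁻ u in Set.Ioc a b, Φ u = ENNReal.ofReal (H b - H a)) ∧
      ∀ᵐ u ∂unif, HasDerivAt H (Φ u).toReal u := by
  have hU : unif = volume.restrict (Set.Ioc (0 : ℝ) 1) := restrict_Ioo_eq_restrict_Ioc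
  rw [hU] at hfin ⊢
  set φ : ℝ → ℝ := (Set.Ioc (0 : ℝ) 1).indicator fun u => (Φ u).toReal with hφ
  have hφ0 : ∀ u, 0 ≤ φ u := fun u => Set.indicator_nonneg (fun _ _ => ENNReal.toReal_nonneg) u
  have hint : Integrable φ := (integrable_indicator_iff measurableSet_Ioc).2
    (integrable_toReal_of_lintegral_ne_top hΦ.aemeasurable hfin)
  have hlt : ∀ᵐ u ∂volume.restrict (Set.Ioc (0 : ℝ) 1), Φ u < ∞ := ae_lt_top hΦ hfin
  refine ⟨fun t => ∫ s in (0 : ℝ)..t, φ s, fun a b ha hab hb => ?_, ?_⟩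
  · have hsub : (∫ s in (0 : ℝ)..b, φ s) - ∫ s in (0 : ℝ)..a, φ s = ∫ s in Set.Ioc a b, φ s := by
      rw [intervalIntegral.integral_interval_sub_left hint.intervalIntegrable
        hint.intervalIntegrable, intervalIntegral.integral_of_le hab]
    have hss : Set.Ioc a b ⊆ Set.Ioc 0 1 := Set.Ioc_subset_Ioc ha hb
    refine ⟨sub_nonneg.1 (hsub ▸ integral_nonneg hφ0), ?_⟩
    simp only [hsub]
    rw [ofReal_integral_eq_lintegral_ofReal hint.restrict (Eventually.of_forall hφ0)]
    refine lintegral_congr_ae ?_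
    filter_upwards [ae_mono (Measure.restrict_mono hss le_rfl) hlt,
      ae_restrict_mem measurableSet_Ioc] with u hu hmem
    rw [hφ, Set.indicator_of_mem (hss hmem), ENNReal.ofReal_toReal hu.ne]
  · filter_upwards [ae_restrict_of_ae (LocallyIntegrable.ae_hasDerivAt_integral hint.locallyIntegrable),
      ae_restrict_mem measurableSet_Ioc] with u hu hmem
    have := hu 0
    rwa [hφ, Set.indicator_of_mem hmem] at this

lemma cell_bounds {N : ℕ} (hN : 0 < N) {u : ℝ} (hu : u ∈ Set.Ioo (0 : ℝ) 1) :
    (0 : ℝ) ≤ ⌊(N : ℝ) * u⌋₊ / N ∧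
    (⌊(N : ℝ) * u⌋₊ : ℝ) / N ≤ (⌊(N : ℝ) * u⌋₊ + 1) / N ∧
    ((⌊(N : ℝ) * u⌋₊ : ℝ) + 1) / N ≤ 1 := by
  have hN' : (0 : ℝ) < N := by exact_mod_cast hN
  refine ⟨by positivity, by gcongr; linarith, ?_⟩
  rw [div_le_one hN']
  exact_mod_cast floor_mul_lt hN hu

/-- The average of `Φ` over the cell of length `1 / N` containing `u`. -/
noncomputable def cellAverage (Φ : ℝ → ℝ≥0∞) (N : ℕ) (u : ℝ) : ℝ≥0∞ :=
  (N : ℝ≥0∞) * ∫⁻ t in Set.Ioc ((⌊(N : ℝ) * u⌋₊ : ℝ) / N) ((⌊(N : ℝ) * u⌋₊ + 1) / N), Φ t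

lemma measurable_cellAverage (Φ : ℝ → ℝ≥0∞) (N : ℕ) : Measurable (cellAverage Φ N) :=
  measurable_comp_floor_mul N
    fun i => (N : ℝ≥0∞) * ∫⁻ t in Set.Ioc ((i : ℝ) / N) ((i + 1) / N), Φ t

lemma lintegral_cellAverage (Φ : ℝ → ℝ≥0∞) {N : ℕ} (hN : 0 < N) :
    ∫⁻ u, cellAverage Φ N u ∂unif = ∫⁻ u, Φ u ∂unif := by
  have hN' : (N : ℝ) ≠ 0 := by exact_mod_cast hN.ne'
  unfold cellAverage
  rw [lintegral_unif_floor hN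
    fun i => (N : ℝ≥0∞) * ∫⁻ t in Set.Ioc ((i : ℝ) / N) ((i + 1) / N), Φ t, ← Finset.mul_sum,
    ← lintegral_Ioc_partition hN, ← mul_assoc, ENNReal.inv_mul_cancel (by simp [hN.ne']) (by simp),
    one_mul, div_self hN', ← restrict_Ioo_eq_restrict_Ioc]

/-- This is Lebesgue differentiation: the average is N times the increment of a primitive between
phases 0 and 1. -/
lemma ae_tendsto_cellAverage {Φ : ℝ → ℝ≥0∞} (hΦ : Measurable Φ) (hfin : ∫⁻ u, Φ u ∂unif ≠ ∞) :
    ∀ᵐ u ∂unif, Tendsto (fun N => cellAverage Φ N u) atTop (𝓝 (Φ u)) := by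
  obtain ⟨H, hH, hd⟩ := exists_primitive hΦ hfin
  filter_upwards [hd, ae_lt_top hΦ hfin, ae_restrict_mem measurableSet_Ioo] with u hdu hlt hu
  have h := ENNReal.tendsto_ofReal (tendsto_mul_sub_of_hasDerivAt hdu hu.1.le (a := 1) (b := 0)
    ⟨zero_le_one, le_rfl⟩ ⟨le_rfl, zero_le_one⟩)
  rw [sub_zero, one_mul, ENNReal.ofReal_toReal hlt.ne] at h
  refine h.congr' ?_
  filter_upwards [eventually_gt_atTop 0] with N hN
  obtain ⟨h0, h1, h2⟩ := cell_bounds hN hu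
  rw [cellAverage, (hH _ _ h0 h1 h2).2, add_zero, ENNReal.ofReal_mul (Nat.cast_nonneg N),
    ENNReal.ofReal_natCast]

/-- A version of the dominated convergence theorem with varying dominating functions, for the
upper limit of iterated integrals. -/
lemma limsup_lintegral_lintegral_le {α β : Type*} [MeasurableSpace α] [MeasurableSpace β]
    (ν : Measure α) (η : Measure β) [IsProbabilityMeasure η] {k : ℕ → α → β → ℝ≥0∞}
    (hk : ∀ N, Measurable (Function.uncurry (k N))) {D : ℕ → α → ℝ≥0∞} (hD : ∀ N, Measurable (D N))
    {Φ : α → ℝ≥0∞} {c : β → ℝ≥0∞} (hΦm : Measurable Φ) (hc : Measurable c)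
    (hfin : ∫⁻ u, Φ u ∂ν ≠ ∞)
    (hle : ∀ᶠ N in atTop, ∀ᵐ u ∂ν, ∀ᵐ w ∂η, k N u w ≤ D N u)
    (hDint : ∀ᶠ N in atTop, ∫⁻ u, D N u ∂ν = ∫⁻ u, Φ u ∂ν)
    (hDlim : ∀ᵐ u ∂ν, Tendsto (fun N => D N u) atTop (𝓝 (Φ u)))
    (hklim : ∀ᵐ u ∂ν, ∀ᵐ w ∂η, ∃ l ≤ Φ u * c w, Tendsto (fun N => k N u w) atTop (𝓝 l)) :
    limsup (fun N => ∫⁻ u, ∫⁻ w, k N u w ∂η ∂ν) atTop ≤ (∫⁻ w, c w ∂η) * ∫⁻ u, Φ u ∂ν := by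
  have hkD : ∀ N, Measurable (Function.uncurry fun u w => D N u - k N u w) := fun N =>
    ((hD N).comp measurable_fst).sub (hk N)
  have hsum : ∀ᶠ N in atTop, ∫⁻ u, ∫⁻ w, k N u w ∂η ∂ν =
      ∫⁻ u, Φ u ∂ν - ∫⁻ u, ∫⁻ w, D N u - k N u w ∂η ∂ν := by
    filter_upwards [hle, hDint] with N hN hN'
    have hadd : ∫⁻ u, ∫⁻ w, k N u w ∂η ∂ν + ∫⁻ u, ∫⁻ w, D N u - k N u w ∂η ∂ν =
        ∫⁻ u, Φ u ∂ν := by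
      rw [← lintegral_add_left (hk N).lintegral_prod_right, ← hN']
      refine lintegral_congr_ae ?_
      filter_upwards [hN] with u hu
      rw [← lintegral_add_left (hk N).of_uncurry_left]
      calc _ = ∫⁻ _w, D N u ∂η := lintegral_congr_ae
            (by filter_upwards [hu] with w hw using add_tsub_cancel_of_le hw)
        _ = _ := by simp
    refine ENNReal.eq_sub_of_add_eq (ne_top_of_le_ne_top hfin ?_) hadd
    exact hadd ▸ le_add_self
  -- Fatou is applied to the nonnegative gaps `D N u - k N u w`.
  have hlim : ∫⁻ u, Φ u ∂ν - (∫⁻ w, c w ∂η) * ∫⁻ u, Φ u ∂ν ≤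
      liminf (fun N => ∫⁻ u, ∫⁻ w, D N u - k N u w ∂η ∂ν) atTop := by
    refine le_trans ?_ (lintegral_lintegral_liminf_le ν η hkD)
    rw [← lintegral_const_mul _ hΦm]
    refine (lintegral_sub_le _ _ (hΦm.const_mul _)).trans (lintegral_mono_ae ?_)
    filter_upwards [hDlim, hklim, ae_lt_top hΦm hfin] with u hu hku hlt
    have h1 : ∫⁻ _w, Φ u ∂η - ∫⁻ w, Φ u * c w ∂η ≤ ∫⁻ w, Φ u - Φ u * c w ∂η :=
      lintegral_sub_le _ _ (hc.const_mul _)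
    rw [lintegral_const_mul _ hc, lintegral_const, measure_univ, mul_one, mul_comm (Φ u)] at h1
    refine h1.trans (lintegral_mono_ae ?_)
    filter_upwards [hku] with w hw
    obtain ⟨l, hl, hlt'⟩ := hw
    rw [(ENNReal.Tendsto.sub hu hlt' (Or.inl hlt.ne)).liminf_eq]
    exact tsub_le_tsub_left hl _
  rw [limsup_congr hsum, ENNReal.limsup_const_sub _ _ hfin]
  -- Truncated subtraction is harmless here: a - (a - b) ≤ b always holds.
  exact (tsub_le_tsub_left hlim _).trans tsub_tsub_le

end General

/-! ### Upper bounds for the midpoint quantiles under a positive density. -/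

section Upper

variable {μ μsing : Measure ℝ} {f : ℝ → ℝ} {A : Set ℝ} {ρ : ℝ}

/-- The derivative of the quantile function in the absence of a singular part. -/
noncomputable def quantileDeriv (μ : Measure ℝ) (A : Set ℝ) (f : ℝ → ℝ) (u : ℝ) : ℝ≥0∞ :=
  A.indicator (fun _ => (1 : ℝ≥0∞)) (quantile μ u) / ENNReal.ofReal (f (quantile μ u))

lemma measurable_quantileDeriv (μ : Measure ℝ) (hf : Measurable f) (hA : MeasurableSet A) :
    Measurable (quantileDeriv μ A f) :=
  ((measurable_const.indicator hA).div hf.ennreal_ofReal).comp (measurable_quantile μ)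

lemma quantileDeriv_rpow (μ : Measure ℝ) (A : Set ℝ) (hf0 : ∀ x, 0 ≤ f x) (hρ : 0 < ρ) (u : ℝ) :
    quantileDeriv μ A f u ^ ρ = densityRpow μ A f ρ u := by
  unfold quantileDeriv densityRpow
  rw [ENNReal.div_rpow_of_nonneg _ _ hρ.le, ENNReal.ofReal_rpow_of_nonneg (hf0 _) hρ.le]
  congr 1
  by_cases h : quantile μ u ∈ A
  · simp [h]
  · simp [h, hρ]

/-- Positivity of the density makes the quantile function absolutely continuous. -/
lemma ofReal_quantile_sub_le [IsProbabilityMeasure μ] (hf : Measurable f)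
    (hμ : μ = volume.withDensity (fun x => ENNReal.ofReal (f x)) + μsing)
    (hA : MeasurableSet A) (hAvol : volume Aᶜ = 0)
    (hpos : ∀ᵐ x ∂(volume : Measure ℝ),
      0 < ProbabilityTheory.cdf μ x → ProbabilityTheory.cdf μ x < 1 → 0 < f x)
    {a b : ℝ} (ha : a ∈ Set.Ioo (0 : ℝ) 1) (hb : b ∈ Set.Ioo (0 : ℝ) 1) :
    ENNReal.ofReal (quantile μ b - quantile μ a) ≤
      ∫⁻ u in Set.Ioc a b, quantileDeriv μ A f u := by
  set J := Set.Ioo (quantile μ a) (quantile μ b) with hJ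
  set h : ℝ → ℝ≥0∞ := fun x => A.indicator (fun _ => (1 : ℝ≥0∞)) x / ENNReal.ofReal (f x) with hh
  have hhm : Measurable h := (measurable_const.indicator hA).div hf.ennreal_ofReal
  have hJh : Measurable (J.indicator h) := hhm.indicator measurableSet_Ioo
  have hAae : ∀ᵐ x, x ∈ A := hAvol
  calc ENNReal.ofReal (quantile μ b - quantile μ a) = ∫⁻ x, J.indicator 1 x := by
        rw [lintegral_indicator_one measurableSet_Ioo, Real.volume_Ioo]
    _ ≤ ∫⁻ x, ENNReal.ofReal (f x) * J.indicator h x := by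
        refine lintegral_mono_ae ?_
        filter_upwards [hpos, hAae] with x hx hxA
        by_cases hxJ : x ∈ J
        · have h1 := (quantile_le_iff μ ha).1 hxJ.1.le
          have h2 := not_le.1 (fun h' => absurd ((quantile_le_iff μ hb).2 h') (not_le.2 hxJ.2))
          have hfx := hx (ha.1.trans_le h1) (h2.trans hb.2)
          rw [Set.indicator_of_mem hxJ, Set.indicator_of_mem hxJ, hh]
          simp only [Set.indicator_of_mem hxA, one_div, Pi.one_apply]
          rw [ENNReal.mul_inv_cancel (by simpa using hfx) (by simp)]
        · simp [hxJ]
    _ = ∫⁻ x, J.indicator h x ∂(volume.withDensity fun x => ENNReal.ofReal (f x)) := by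
        rw [lintegral_withDensity_eq_lintegral_mul _ hf.ennreal_ofReal hJh]
        rfl
    -- Discarding the singular part only decreases the measure.
    _ ≤ ∫⁻ x, J.indicator h x ∂μ := by
        conv_rhs => rw [hμ]
        rw [lintegral_add_measure]
        exact le_self_add
    _ = ∫⁻ u, J.indicator h (quantile μ u) ∂unif := by
        conv_lhs => rw [← map_quantile μ]
        rw [lintegral_map hJh (measurable_quantile μ)]
    _ ≤ ∫⁻ u, (Set.Ioc a b).indicator (quantileDeriv μ A f) u ∂unif := by
        refine setLIntegral_mono_ae' measurableSet_Ioo (Eventually.of_forall fun u hu => ?_)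
        by_cases huJ : quantile μ u ∈ J
        · have h1 : a < u := by
            by_contra! h'
            exact absurd (monotoneOn_quantile μ hu ha h') (not_le.2 huJ.1)
          have h2 : u < b := by
            by_contra! h'
            exact absurd (monotoneOn_quantile μ hb hu h') (not_le.2 huJ.2)
          rw [Set.indicator_of_mem huJ, Set.indicator_of_mem (Set.mem_Ioc.2 ⟨h1, h2.le⟩), hh, quantileDeriv]
        · rw [Set.indicator_of_notMem huJ]
          exact zero_le
    _ ≤ ∫⁻ u, (Set.Ioc a b).indicator (quantileDeriv μ A f) u :=
        lintegral_mono' Measure.restrict_le_self le_rfl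
    _ = _ := lintegral_indicator measurableSet_Ioc _

/-- Rescaled cost when the points are the quantiles at the midpoints of the cells. -/
noncomputable def midCost (ρ : ℝ) (μ : Measure ℝ) (N : ℕ) (u w : ℝ) : ℝ≥0∞ :=
  ENNReal.ofReal (|(N : ℝ) * (quantile μ ((⌊(N : ℝ) * u⌋₊ + w) / N) -
    quantile μ ((⌊(N : ℝ) * u⌋₊ + 1 / 2) / N))| ^ ρ)

lemma measurable_midCost (ρ : ℝ) (μ : Measure ℝ) (N : ℕ) :
    Measurable (Function.uncurry (midCost ρ μ N)) := by
  have hq := measurable_quantile μ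
  have hfl : Measurable fun p : ℝ × ℝ => (⌊(N : ℝ) * p.1⌋₊ : ℝ) :=
    (measurable_comp_floor_mul N fun k => (k : ℝ)).comp measurable_fst
  unfold midCost Function.uncurry
  fun_prop

lemma midpoint_mem_Ioo {N : ℕ} {i : ℕ} (hi : i < N) :
    ((i : ℝ) + 1 / 2) / N ∈ Set.Ioo (0 : ℝ) 1 := by
  have hN' : (0 : ℝ) < N := by exact_mod_cast (Nat.zero_le i).trans_lt hi
  have hi' : (i : ℝ) + 1 ≤ N := by exact_mod_cast hi
  refine ⟨by positivity, ?_⟩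
  rw [div_lt_one hN']
  linarith

lemma midQuantiles_eq (N : ℕ) (μ : Measure ℝ) :
    midQuantiles N μ = fun i : Fin N => quantile μ (((i : ℕ) + 1 / 2) / N) := by
  ext i
  unfold midQuantiles
  congr 1
  rw [mul_comm 2 (N : ℝ), ← div_div, div_right_comm]
  congr 1
  ring

lemma quantile_midpoint_mono (μ : Measure ℝ) (N : ℕ) (i j : ℕ) (hij : i ≤ j) (hj : j < N) :
    quantile μ (((i : ℝ) + 1 / 2) / N) ≤ quantile μ (((j : ℝ) + 1 / 2) / N) :=
  monotoneOn_quantile μ (midpoint_mem_Ioo (hij.trans_lt hj)) (midpoint_mem_Ioo hj) (by gcongr)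

lemma monotone_midQuantiles (N : ℕ) (μ : Measure ℝ) : Monotone (midQuantiles N μ) := by
  rw [midQuantiles_eq]
  exact fun i j hij => quantile_midpoint_mono μ N i j hij j.2

lemma minError_le_midQuantiles (N : ℕ) (μ : Measure ℝ) (ρ : ℝ) :
    minError N μ ρ ≤ wasserstein ρ (empirical (midQuantiles N μ)) μ :=
  iInf₂_le (midQuantiles N μ) (monotone_midQuantiles N μ)

lemma mul_wasserstein_midQuantiles (hρ : 1 ≤ ρ) (μ : Measure ℝ) [IsProbabilityMeasure μ] {N : ℕ}
    (hN : 0 < N) : (N : ℝ≥0∞) * wasserstein ρ (empirical (midQuantiles N μ)) μ =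
      (∫⁻ u, ∫⁻ w, midCost ρ μ N u w ∂unif ∂unif) ^ (1 / ρ) := by
  have hρ0 : 0 < ρ := by linarith
  have hN' : (0 : ℝ) ≤ N := Nat.cast_nonneg N
  have hcast : (N : ℝ≥0∞) ^ ρ = ENNReal.ofReal ((N : ℝ) ^ ρ) := by
    rw [← ENNReal.ofReal_rpow_of_nonneg hN' hρ0.le, ENNReal.ofReal_natCast]
  have hcost : ∫⁻ u, ∫⁻ w, midCost ρ μ N u w ∂unif ∂unif = (N : ℝ≥0∞) ^ ρ * ∫⁻ u, ENNReal.ofReal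
      (|quantile μ ((⌊(N : ℝ) * u⌋₊ + 1 / 2) / N) - quantile μ u| ^ ρ) ∂unif := by
    rw [lintegral_unif_phase hN fun u => ENNReal.ofReal
      (|quantile μ ((⌊(N : ℝ) * u⌋₊ + 1 / 2) / N) - quantile μ u| ^ ρ), hcast,
      ← lintegral_const_mul' _ _ ENNReal.ofReal_ne_top]
    refine lintegral_congr fun u => ?_
    rw [← lintegral_const_mul' _ _ ENNReal.ofReal_ne_top]
    refine setLIntegral_congr_fun measurableSet_Ioo fun w hw => ?_
    simp only [floor_mul_div hN _ hw, midCost]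
    rw [← ENNReal.ofReal_mul (by positivity), abs_mul, abs_of_nonneg hN',
      Real.mul_rpow hN' (abs_nonneg _), abs_sub_comm]
  rw [midQuantiles_eq, wasserstein_empirical hρ μ hN (quantile_midpoint_mono μ N), hcost,
    ENNReal.mul_rpow_of_nonneg _ _ (by positivity), ← ENNReal.rpow_mul,
    mul_one_div_cancel hρ0.ne', ENNReal.rpow_one]

/-- Jensen on the unit interval: finiteness of the ρ-th moment implies that of the first. -/
lemma lintegral_quantileDeriv_ne_top (hρ : 1 ≤ ρ) (hf : Measurable f) (hf0 : ∀ x, 0 ≤ f x)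
    (hA : MeasurableSet A) (hI : densityIntegral μ A f ρ ≠ ∞) :
    ∫⁻ u, quantileDeriv μ A f u ∂unif ≠ ∞ := by
  have hρ0 : 0 < ρ := by linarith
  have h := setLIntegral_rpow_le hρ (measurable_quantileDeriv μ hf hA) (Set.Ioo (0 : ℝ) 1)
  simp only [quantileDeriv_rpow μ A hf0 hρ0, Real.volume_Ioo, sub_zero, ENNReal.ofReal_one,
    ENNReal.one_rpow, one_mul] at h
  rw [← densityIntegral_eq] at h
  intro htop
  rw [htop, ENNReal.top_rpow_of_pos hρ0, top_le_iff] at h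
  exact hI h

lemma tendsto_midCost (hρ : 1 ≤ ρ) {u g w : ℝ}
    (hu : u ∈ Set.Ioo (0 : ℝ) 1) (hg : HasDerivAt (quantile μ) g u) (hw : w ∈ Set.Ioo (0 : ℝ) 1) :
    Tendsto (fun N => midCost ρ μ N u w) atTop
      (𝓝 (ENNReal.ofReal |g| ^ ρ * ENNReal.ofReal (|w - 1 / 2| ^ ρ))) := by
  have hρ0 : 0 ≤ ρ := by linarith
  have h := tendsto_mul_sub_of_hasDerivAt hg hu.1.le (Set.Ioo_subset_Icc_self hw)
    (b := 1 / 2) ⟨by norm_num, by norm_num⟩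
  have h2 := ENNReal.tendsto_ofReal ((h.abs.rpow_const (p := ρ) (Or.inr hρ0)))
  rw [mul_comm, abs_mul, Real.mul_rpow (abs_nonneg _) (abs_nonneg _),
    ENNReal.ofReal_mul (by positivity)] at h2
  rw [ENNReal.ofReal_rpow_of_nonneg (abs_nonneg _) hρ0]
  exact h2

section Positive

variable [IsProbabilityMeasure μ]

lemma ofReal_abs_quantile_sub_le (hf : Measurable f)
    (hμ : μ = volume.withDensity (fun x => ENNReal.ofReal (f x)) + μsing)
    (hA : MeasurableSet A) (hAvol : volume Aᶜ = 0)
    (hpos : ∀ᵐ x ∂(volume : Measure ℝ),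
      0 < ProbabilityTheory.cdf μ x → ProbabilityTheory.cdf μ x < 1 → 0 < f x)
    {a b : ℝ} (ha : a ∈ Set.Ioo (0 : ℝ) 1) (hb : b ∈ Set.Ioo (0 : ℝ) 1) :
    ENNReal.ofReal |quantile μ b - quantile μ a| ≤
      ∫⁻ u in Set.uIoc a b, quantileDeriv μ A f u := by
  rcases le_total a b with hab | hab
  · rw [abs_of_nonneg (sub_nonneg.2 (monotoneOn_quantile μ ha hb hab)), Set.uIoc_of_le hab]
    exact ofReal_quantile_sub_le hf hμ hA hAvol hpos ha hb
  · rw [abs_of_nonpos (sub_nonpos.2 (monotoneOn_quantile μ hb ha hab)), neg_sub,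
      Set.uIoc_of_ge hab]
    exact ofReal_quantile_sub_le hf hμ hA hAvol hpos hb ha

/-- Hölder on an interval of length |w - 1/2| / N leaves the factor N^ρ (|w - 1/2| / N)^(ρ-1) = N |w
- 1/2|^(ρ-1). -/
lemma midCost_le (hρ : 1 ≤ ρ) (hf : Measurable f) (hf0 : ∀ x, 0 ≤ f x)
    (hμ : μ = volume.withDensity (fun x => ENNReal.ofReal (f x)) + μsing)
    (hA : MeasurableSet A) (hAvol : volume Aᶜ = 0)
    (hpos : ∀ᵐ x ∂(volume : Measure ℝ),
      0 < ProbabilityTheory.cdf μ x → ProbabilityTheory.cdf μ x < 1 → 0 < f x)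
    {N : ℕ} (hN : 0 < N) {u w : ℝ} (hu : u ∈ Set.Ioo (0 : ℝ) 1) (hw : w ∈ Set.Ioo (0 : ℝ) 1) :
    midCost ρ μ N u w ≤ ENNReal.ofReal (|w - 1 / 2| ^ (ρ - 1)) *
      ((N : ℝ≥0∞) * ∫⁻ t in Set.uIoc ((⌊(N : ℝ) * u⌋₊ + 1 / 2) / (N : ℝ))
        ((⌊(N : ℝ) * u⌋₊ + w) / N), densityRpow μ A f ρ t) := by
  have hρ0 : 0 < ρ := by linarith
  have hN' : (0 : ℝ) < N := by exact_mod_cast hN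
  set m : ℝ := (⌊(N : ℝ) * u⌋₊ + 1 / 2) / (N : ℝ) with hm
  set v : ℝ := (⌊(N : ℝ) * u⌋₊ + w) / (N : ℝ) with hv
  have hmI : m ∈ Set.Ioo (0 : ℝ) 1 := floor_add_div_mem_Ioo hu ⟨by norm_num, by norm_num⟩ hN
  have hvI : v ∈ Set.Ioo (0 : ℝ) 1 := floor_add_div_mem_Ioo hu hw hN
  have hvm : |v - m| = |w - 1 / 2| / N := by
    rw [hv, hm, ← sub_div, abs_div, abs_of_pos hN', add_sub_add_left_eq_sub]
  have h1 := (ENNReal.rpow_le_rpow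
    (ofReal_abs_quantile_sub_le hf hμ hA hAvol hpos hmI hvI) hρ0.le).trans
    (setLIntegral_rpow_le hρ (measurable_quantileDeriv μ hf hA) (Set.uIoc m v))
  simp only [quantileDeriv_rpow μ A hf0 hρ0] at h1
  have hvol : volume (Set.uIoc m v) = ENNReal.ofReal (|w - 1 / 2| / N) := by
    rw [Real.volume_uIoc, hvm]
  have hscale : ENNReal.ofReal ((N : ℝ) ^ ρ) * ENNReal.ofReal (|w - 1 / 2| / N) ^ (ρ - 1) =
      ENNReal.ofReal (|w - 1 / 2| ^ (ρ - 1)) * (N : ℝ≥0∞) := by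
    rw [ENNReal.ofReal_rpow_of_nonneg (by positivity) (by linarith),
      ← ENNReal.ofReal_mul (by positivity), ← ENNReal.ofReal_natCast N,
      ← ENNReal.ofReal_mul (by positivity)]
    congr 1
    rw [Real.div_rpow (abs_nonneg _) hN'.le, Real.rpow_sub_one hN'.ne']
    have := (Real.rpow_pos_of_pos hN' ρ).ne'
    field_simp
  calc midCost ρ μ N u w
      = ENNReal.ofReal ((N : ℝ) ^ ρ) * ENNReal.ofReal |quantile μ v - quantile μ m| ^ ρ := by
        rw [midCost, abs_mul, abs_of_pos hN', Real.mul_rpow hN'.le (abs_nonneg _),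
          ENNReal.ofReal_mul (by positivity),
          ENNReal.ofReal_rpow_of_nonneg (abs_nonneg _) hρ0.le]
    _ ≤ ENNReal.ofReal ((N : ℝ) ^ ρ) * (ENNReal.ofReal (|w - 1 / 2| / N) ^ (ρ - 1) *
        ∫⁻ t in Set.uIoc m v, densityRpow μ A f ρ t) := by
        rw [← hvol]
        gcongr
    _ = _ := by rw [← mul_assoc, hscale, mul_assoc]

lemma lintegral_Ioc_add_le (Φ : ℝ → ℝ≥0∞) {l a m b r : ℝ} (hl : l ≤ a) (ham : a ≤ m)
    (hmb : m ≤ b) (hr : b ≤ r) :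
    (∫⁻ t in Set.Ioc a m, Φ t) + ∫⁻ t in Set.Ioc m b, Φ t ≤ ∫⁻ t in Set.Ioc l r, Φ t := by
  rw [← lintegral_union measurableSet_Ioc (Set.Ioc_disjoint_Ioc_of_le le_rfl),
    Set.Ioc_union_Ioc_eq_Ioc ham hmb]
  exact lintegral_mono_set (Set.Ioc_subset_Ioc hl hr)

/-- The phases w and 1 - w lie on opposite sides of the midpoint, so the two intervals are disjoint
inside the cell. -/
lemma lintegral_uIoc_reflect_add_le (Φ : ℝ → ℝ≥0∞) (N i : ℕ) {w : ℝ}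
    (hw : w ∈ Set.Ioo (0 : ℝ) 1) :
    (∫⁻ t in Set.uIoc (((i : ℝ) + 1 / 2) / N) ((i + w) / N), Φ t) +
      ∫⁻ t in Set.uIoc (((i : ℝ) + 1 / 2) / N) ((i + (1 - w)) / N), Φ t ≤
      ∫⁻ t in Set.Ioc ((i : ℝ) / N) ((i + 1) / N), Φ t := by
  have hN' : (0 : ℝ) ≤ N := Nat.cast_nonneg N
  have h1 : ∀ x y : ℝ, x ≤ y → ((i : ℝ) + x) / N ≤ (i + y) / N := fun x y h => by gcongr
  have h0 : ∀ x : ℝ, 0 ≤ x → (i : ℝ) / N ≤ (i + x) / N := fun x h => by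
    simpa using h1 0 x h
  rcases le_total w (1 / 2) with h | h
  · rw [Set.uIoc_of_ge (h1 _ _ h), Set.uIoc_of_le (h1 _ _ (by linarith))]
    exact lintegral_Ioc_add_le Φ (h0 _ hw.1.le) (h1 _ _ h) (h1 _ _ (by linarith))
      (h1 _ _ (by linarith [hw.1]))
  · rw [Set.uIoc_of_le (h1 _ _ h), Set.uIoc_of_ge (h1 _ _ (by linarith)), add_comm]
    exact lintegral_Ioc_add_le Φ (h0 _ (by linarith [hw.2])) (h1 _ _ (by linarith)) (h1 _ _ h)
      (h1 _ _ hw.2.le)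

lemma two_mul_lintegral_le_of_symm {h k : ℝ → ℝ≥0∞} (hm : Measurable h)
    (hk : ∀ w ∈ Set.Ioo (0 : ℝ) 1, h w + h (1 - w) ≤ k w) :
    2 * ∫⁻ w, h w ∂unif ≤ ∫⁻ w, k w ∂unif := by
  have h1 : ∫⁻ w, h w + h (1 - w) ∂unif ≤ ∫⁻ w, k w ∂unif :=
    setLIntegral_mono_ae' measurableSet_Ioo (Eventually.of_forall hk)
  rwa [lintegral_add_left hm, lintegral_unif_reflect h, ← two_mul] at h1

lemma lintegral_midCost_le (hρ : 1 ≤ ρ) (hf : Measurable f) (hf0 : ∀ x, 0 ≤ f x)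
    (hμ : μ = volume.withDensity (fun x => ENNReal.ofReal (f x)) + μsing)
    (hA : MeasurableSet A) (hAvol : volume Aᶜ = 0)
    (hpos : ∀ᵐ x ∂(volume : Measure ℝ),
      0 < ProbabilityTheory.cdf μ x → ProbabilityTheory.cdf μ x < 1 → 0 < f x)
    {N : ℕ} (hN : 0 < N) :
    ∫⁻ u, ∫⁻ w, midCost ρ μ N u w ∂unif ∂unif ≤
      ENNReal.ofReal (1 / (2 ^ ρ * ρ)) * densityIntegral μ A f ρ := by
  have hρ0 : 0 < ρ := by linarith
  have hcell : ∀ u ∈ Set.Ioo (0 : ℝ) 1, 2 * ∫⁻ w, midCost ρ μ N u w ∂unif ≤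
      ENNReal.ofReal (1 / (2 ^ (ρ - 1) * ρ)) * cellAverage (densityRpow μ A f ρ) N u := by
    intro u hu
    refine (two_mul_lintegral_le_of_symm (measurable_midCost ρ μ N).of_uncurry_left
      (k := fun w => ENNReal.ofReal (|w - 1 / 2| ^ (ρ - 1)) *
        cellAverage (densityRpow μ A f ρ) N u) fun w hw => ?_).trans (le_of_eq ?_)
    · have hw' : 1 - w ∈ Set.Ioo (0 : ℝ) 1 := ⟨by linarith [hw.2], by linarith [hw.1]⟩
      have h1 := midCost_le hρ hf hf0 hμ hA hAvol hpos hN hu hw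
      have h2 := midCost_le hρ hf hf0 hμ hA hAvol hpos hN hu hw'
      rw [show |1 - w - 1 / 2| = |w - 1 / 2| by rw [← abs_neg]; ring_nf] at h2
      refine (add_le_add h1 h2).trans ?_
      rw [← mul_add, ← mul_add, cellAverage]
      gcongr
      exact lintegral_uIoc_reflect_add_le _ N _ hw
    · have hm : Measurable fun w : ℝ => ENNReal.ofReal (|w - 1 / 2| ^ (ρ - 1)) := by fun_prop
      -- The moment of order ρ - 1 is 1 / (2^(ρ-1) ρ); this is where ρ replaces ρ + 1.
      rw [lintegral_mul_const _ hm, lintegral_abs_sub_half_rpow (by linarith), sub_add_cancel]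
  have h2 : 2 * ∫⁻ u, ∫⁻ w, midCost ρ μ N u w ∂unif ∂unif ≤
      2 * (ENNReal.ofReal (1 / (2 ^ ρ * ρ)) * densityIntegral μ A f ρ) := by
    rw [← lintegral_const_mul' _ _ (by simp)]
    refine (setLIntegral_mono_ae' measurableSet_Ioo (Eventually.of_forall hcell)).trans
      (le_of_eq ?_)
    rw [lintegral_const_mul' _ _ ENNReal.ofReal_ne_top, lintegral_cellAverage _ hN,
      densityIntegral_eq, ← mul_assoc]
    congr 1
    rw [show (2 : ℝ≥0∞) = ENNReal.ofReal 2 by simp, ← ENNReal.ofReal_mul (by norm_num),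
      Real.rpow_sub_one (by norm_num)]
    congr 1
    field_simp
  exact (ENNReal.mul_le_mul_iff_right (by simp) (by simp)).1 h2

lemma ae_abs_deriv_quantile_le (hf : Measurable f)
    (hμ : μ = volume.withDensity (fun x => ENNReal.ofReal (f x)) + μsing)
    (hA : MeasurableSet A) (hAvol : volume Aᶜ = 0)
    (hpos : ∀ᵐ x ∂(volume : Measure ℝ),
      0 < ProbabilityTheory.cdf μ x → ProbabilityTheory.cdf μ x < 1 → 0 < f x)
    (hfin : ∫⁻ u, quantileDeriv μ A f u ∂unif ≠ ∞) :
    ∀ᵐ u ∂unif, ∀ g, HasDerivAt (quantile μ) g u → ENNReal.ofReal |g| ≤ quantileDeriv μ A f u := by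
  have hm := measurable_quantileDeriv μ hf hA
  obtain ⟨H, hH, hd⟩ := exists_primitive hm hfin
  filter_upwards [hd, ae_lt_top hm hfin, ae_restrict_mem measurableSet_Ioo] with u hdu hlt hu g hg
  -- Interior phases keep both points inside (0, 1); phases 0 and 1 could reach the endpoints, where
  -- the quantile bound is not available.
  have ha : (3 / 4 : ℝ) ∈ Set.Ioo (0 : ℝ) 1 := ⟨by norm_num, by norm_num⟩
  have hb : (1 / 4 : ℝ) ∈ Set.Ioo (0 : ℝ) 1 := ⟨by norm_num, by norm_num⟩
  have h1 := (tendsto_mul_sub_of_hasDerivAt hg hu.1.le (Set.Ioo_subset_Icc_self ha)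
    (Set.Ioo_subset_Icc_self hb)).abs
  have h2 := tendsto_mul_sub_of_hasDerivAt hdu hu.1.le (Set.Ioo_subset_Icc_self ha)
    (Set.Ioo_subset_Icc_self hb)
  have h3 : |(3 / 4 - 1 / 4) * g| ≤ (3 / 4 - 1 / 4) * (quantileDeriv μ A f u).toReal := by
    refine le_of_tendsto_of_tendsto h1 h2 ?_
    filter_upwards [eventually_gt_atTop 0] with N hN
    have hva := floor_add_div_mem_Ioo (N := N) hu ha hN
    have hvb := floor_add_div_mem_Ioo (N := N) hu hb hN
    have hab : ((⌊(N : ℝ) * u⌋₊ : ℝ) + 1 / 4) / N ≤ (⌊(N : ℝ) * u⌋₊ + 3 / 4) / N := by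
      gcongr; norm_num
    obtain ⟨hle, heq⟩ := hH _ _ hvb.1.le hab hva.2.le
    have h4 := ofReal_abs_quantile_sub_le hf hμ hA hAvol hpos hvb hva
    rw [Set.uIoc_of_le hab, heq] at h4
    rw [abs_mul, Nat.abs_cast]
    exact mul_le_mul_of_nonneg_left
      ((ENNReal.ofReal_le_ofReal_iff (sub_nonneg.2 hle)).1 h4) (Nat.cast_nonneg N)
  rw [abs_mul, abs_of_pos (by norm_num)] at h3
  exact ENNReal.ofReal_le_of_le_toReal (le_of_mul_le_mul_left h3 (by norm_num))

lemma limsup_midCost_le (hρ : 1 ≤ ρ) (hf : Measurable f) (hf0 : ∀ x, 0 ≤ f x)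
    (hμ : μ = volume.withDensity (fun x => ENNReal.ofReal (f x)) + μsing)
    (hA : MeasurableSet A) (hAsing : μsing A = 0) (hAvol : volume Aᶜ = 0)
    (hpos : ∀ᵐ x ∂(volume : Measure ℝ),
      0 < ProbabilityTheory.cdf μ x → ProbabilityTheory.cdf μ x < 1 → 0 < f x)
    (hI : densityIntegral μ A f ρ ≠ ∞) :
    limsup (fun N => ∫⁻ u, ∫⁻ w, midCost ρ μ N u w ∂unif ∂unif) atTop ≤
      ENNReal.ofReal (1 / (2 ^ ρ * (ρ + 1))) * densityIntegral μ A f ρ := by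
  have hρ0 : 0 < ρ := by linarith
  have hprob : IsProbabilityMeasure unif := ⟨by simp⟩
  have hΦm : Measurable (densityRpow μ A f ρ) := by
    rw [show densityRpow μ A f ρ = fun u => quantileDeriv μ A f u ^ ρ from
      funext fun u => (quantileDeriv_rpow μ A hf0 hρ0 u).symm]
    exact (measurable_quantileDeriv μ hf hA).pow_const ρ
  rw [← lintegral_abs_sub_half_rpow hρ0.le, densityIntegral_eq]
  rw [densityIntegral_eq] at hI
  refine limsup_lintegral_lintegral_le unif unif (k := midCost ρ μ) (measurable_midCost ρ μ)
    (D := cellAverage (densityRpow μ A f ρ)) (measurable_cellAverage _) hΦm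
    (c := fun w => ENNReal.ofReal (|w - 1 / 2| ^ ρ)) (by fun_prop) hI ?_ ?_
    (ae_tendsto_cellAverage hΦm hI) ?_
  · filter_upwards [eventually_gt_atTop 0] with N hN
    filter_upwards [ae_restrict_mem measurableSet_Ioo] with u hu
    filter_upwards [ae_restrict_mem measurableSet_Ioo] with w hw
    refine (midCost_le hρ hf hf0 hμ hA hAvol hpos hN hu hw).trans ?_
    -- Bounding the phase factor by 1 makes the dominating function a plain cell average,
    -- independent of w.
    have h1 : |w - 1 / 2| ^ (ρ - 1) ≤ 1 := by
      refine Real.rpow_le_one (abs_nonneg _) (abs_le.2 ?_) (by linarith)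
      constructor <;> linarith [hw.1, hw.2]
    refine (mul_le_of_le_one_left' (ENNReal.ofReal_le_one.2 h1)).trans ?_
    refine mul_le_mul_right ?_ _
    exact le_self_add.trans (lintegral_uIoc_reflect_add_le _ N _ hw)
  · filter_upwards [eventually_gt_atTop 0] with N hN using lintegral_cellAverage _ hN
  · filter_upwards [ae_hasDerivAt_quantile hf hf0 hμ hA hAsing hAvol,
      ae_abs_deriv_quantile_le hf hμ hA hAvol hpos
        (lintegral_quantileDeriv_ne_top hρ hf hf0 hA hI)] with u hu hgu
    obtain ⟨hu, g, hg, -⟩ := hu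
    filter_upwards [ae_restrict_mem measurableSet_Ioo] with w hw
    refine ⟨_, ?_, tendsto_midCost hρ hu hg hw⟩
    rw [← quantileDeriv_rpow μ A hf0 hρ0]
    gcongr
    exact hgu g hg

theorem mul_wasserstein_midQuantiles_le (hρ : 1 ≤ ρ) (hf : Measurable f) (hf0 : ∀ x, 0 ≤ f x)
    (hμ : μ = volume.withDensity (fun x => ENNReal.ofReal (f x)) + μsing)
    (hA : MeasurableSet A) (hAvol : volume Aᶜ = 0)
    (hpos : ∀ᵐ x ∂(volume : Measure ℝ),
      0 < ProbabilityTheory.cdf μ x → ProbabilityTheory.cdf μ x < 1 → 0 < f x)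
    {N : ℕ} (hN : 0 < N) :
    (N : ℝ≥0∞) * wasserstein ρ (empirical (midQuantiles N μ)) μ ≤
      ENNReal.ofReal (1 / (2 * ρ ^ (1 / ρ))) * densityIntegral μ A f ρ ^ (1 / ρ) := by
  rw [mul_wasserstein_midQuantiles hρ μ hN, ← constant_rpow hρ (by linarith)]
  exact ENNReal.rpow_le_rpow (lintegral_midCost_le hρ hf hf0 hμ hA hAvol hpos hN) (by positivity)

lemma ENNReal.rpow_limsup {α : Type*} {l : Filter α} (F : α → ℝ≥0∞) {s : ℝ} (hs : 0 < s) :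
    (limsup F l) ^ s = limsup (fun a => F a ^ s) l :=
  (ENNReal.orderIsoRpow s hs).limsup_apply

theorem limsup_mul_wasserstein_midQuantiles_le (hρ : 1 ≤ ρ) (hf : Measurable f) (hf0 : ∀ x, 0 ≤ f x)
    (hμ : μ = volume.withDensity (fun x => ENNReal.ofReal (f x)) + μsing)
    (hA : MeasurableSet A) (hAsing : μsing A = 0) (hAvol : volume Aᶜ = 0)
    (hpos : ∀ᵐ x ∂(volume : Measure ℝ),
      0 < ProbabilityTheory.cdf μ x → ProbabilityTheory.cdf μ x < 1 → 0 < f x) :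
    limsup (fun N : ℕ => (N : ℝ≥0∞) * wasserstein ρ (empirical (midQuantiles N μ)) μ) atTop ≤
      ENNReal.ofReal (1 / (2 * (ρ + 1) ^ (1 / ρ))) * densityIntegral μ A f ρ ^ (1 / ρ) := by
  have hρ0 : 0 < ρ := by linarith
  by_cases hI : densityIntegral μ A f ρ = ∞
  · have hc : ENNReal.ofReal (1 / (2 * (ρ + 1) ^ (1 / ρ))) ≠ 0 := by
      have : 0 < 1 / (2 * (ρ + 1) ^ (1 / ρ)) := by positivity
      simpa using this
    rw [hI, ENNReal.top_rpow_of_pos (by positivity), ENNReal.mul_top hc]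
    exact le_top
  rw [← constant_rpow hρ (by linarith)]
  refine le_trans (le_of_eq ?_) (ENNReal.rpow_le_rpow
    (limsup_midCost_le hρ hf hf0 hμ hA hAsing hAvol hpos hI) (by positivity))
  rw [ENNReal.rpow_limsup _ (by positivity)]
  refine limsup_congr ?_
  filter_upwards [eventually_gt_atTop 0] with N hN using mul_wasserstein_midQuantiles hρ μ hN

end Positive

end Upper

end EmpiricalApprox

/-! ### Assembly: both sequences are squeezed between the matching bounds. -/

theorem theorem1 (ρ : ℝ) (hρ : 1 ≤ ρ) (μ : Measure ℝ) [IsProbabilityMeasure μ]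
    (f : ℝ → ℝ) (hf : Measurable f) (hf0 : ∀ x, 0 ≤ f x)
    (μsing : Measure ℝ)
    (hμ : μ = volume.withDensity (fun x => ENNReal.ofReal (f x)) + μsing)
    (A : Set ℝ) (hA : MeasurableSet A) (hAsing : μsing A = 0) (hAvol : volume Aᶜ = 0) :
    ENNReal.ofReal (1 / (2 * (ρ + 1) ^ (1 / ρ))) * densityIntegral μ A f ρ ^ (1 / ρ)
        ≤ liminf (fun N : ℕ => (N : ℝ≥0∞) * minError N μ ρ) atTop ∧
    ((∀ᵐ x ∂(volume : Measure ℝ),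
        0 < ProbabilityTheory.cdf μ x → ProbabilityTheory.cdf μ x < 1 → 0 < f x) →
      (⨆ (N : ℕ) (_ : 1 ≤ N), (N : ℝ≥0∞) * minError N μ ρ)
          ≤ (⨆ (N : ℕ) (_ : 1 ≤ N),
              (N : ℝ≥0∞) * wasserstein ρ (empirical (midQuantiles N μ)) μ) ∧
      (⨆ (N : ℕ) (_ : 1 ≤ N),
              (N : ℝ≥0∞) * wasserstein ρ (empirical (midQuantiles N μ)) μ)
          ≤ ENNReal.ofReal (1 / (2 * ρ ^ (1 / ρ))) * densityIntegral μ A f ρ ^ (1 / ρ) ∧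
      Tendsto (fun N : ℕ => (N : ℝ≥0∞) * minError N μ ρ) atTop
        (𝓝 (ENNReal.ofReal (1 / (2 * (ρ + 1) ^ (1 / ρ)))
              * densityIntegral μ A f ρ ^ (1 / ρ))) ∧
      Tendsto (fun N : ℕ => (N : ℝ≥0∞) * wasserstein ρ (empirical (midQuantiles N μ)) μ) atTop
        (𝓝 (ENNReal.ofReal (1 / (2 * (ρ + 1) ^ (1 / ρ)))
              * densityIntegral μ A f ρ ^ (1 / ρ)))) := by
  have hlow := le_liminf_minError hρ hf hf0 hμ hA hAsing hAvol
  refine ⟨hlow, fun hpos => ?_⟩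
  have hup := limsup_mul_wasserstein_midQuantiles_le hρ hf hf0 hμ hA hAsing hAvol hpos
  have hle : (fun N : ℕ => (N : ℝ≥0∞) * minError N μ ρ) ≤
      fun N : ℕ => (N : ℝ≥0∞) * wasserstein ρ (empirical (midQuantiles N μ)) μ := fun N =>
    mul_le_mul_right (minError_le_midQuantiles N μ ρ) _
  refine ⟨iSup₂_mono fun N _ => hle N,
    iSup₂_le fun N hN => mul_wasserstein_midQuantiles_le hρ hf hf0 hμ hA hAvol hpos hN,
    tendsto_of_le_liminf_of_limsup_le hlow
      ((limsup_le_limsup (Eventually.of_forall hle)).trans hup),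
    tendsto_of_le_liminf_of_limsup_le
      (hlow.trans (liminf_le_liminf (Eventually.of_forall hle))) hup⟩
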